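/- **Setting.** Let $\mathcal X$ be a measurable space, $\mathcal Y$ a finite label set, and $\Phi:\mathcal X\times\mathcal Y\to\mathbb R^m$ a measurable feature mapping with $\|\Phi(x,y)\|_\infty\le M$ for all $(x,y)$. All operations on vectors of $\mathbb R^m$ (squares, square roots, quotients, $\preceq$) are componentwise. A classification rule $h$ assigns label $y$ to $x$ with probability $h(y|x)$; its expected 0-1 loss under a distribution $q$ is $\ell(h,q)=\mathbb E_q\{1-h(y|x)\}$. For a set $\mathcal U$ of probability distributions on $\mathcal X\times\mathcal Y$, its minimax risk is $R(\mathcal U)=\inf_h\sup_{q\in\mathcal U}\ell(h,q)$. For $\tau,\lambda\in\mathbb R^m$ let $\mathcal U(\tau,\lambda)=\{q:|\mathbb E_q\Phi-\tau|\preceq\lambda\}$; an MRC parameter for $(\tau,\lambda)$ is any minimizer over $\mu\in\mathbb R^m$ of $$1-\tau^{\rm T}\mu+\sup_{x\in\mathcal X,\ \emptyset\ne\mathcal C\subseteq\mathcal Y}\frac{\sum_{y\in\mathcal C}\Phi(x,y)^{\rm T}\mu-1}{|\mathcal C|}+\lambda^{\rm T}|\mu| .$$ Let $p_1,\dots,p_k$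 be random probability distributions on $\mathcal X\times\mathcal Y$ whose consecutive changes $p_2-p_1,\dots,p_k-p_{k-1}$ are independent and zero-mean (evolving task assumption). Given $p_1,\dots,p_k$, all samples are independent, and the sample set $D_j$ consists of $n_j\ge1$ samples $(x_{j,i},y_{j,i})$ from $p_j$. Let $\tau_j^\infty=\mathbb E_{p_j}\Phi$, $w_j=\tau_j^\infty-\tau_{j-1}^\infty$, $R_j^\infty=R(\mathcal U(\tau_j^\infty,0))$, and let $\mu_j^\infty$ be an MRC parameter for $(\tau_j^\infty,0)$. Assume that the set $\{(\Phi(x,y))_{y\in\mathcal Y}:x\in\mathcal X\}$ is closed (for instance, $\mathcal X$ is finite, or $\mathcal X$ is compact and $\Phi(\cdot,y)$ is continuous for every $y$), or that almost surely every $\tau_j^\infty$ lies in the relative interior of the convex hull of $\Phi(\mathcal X\times\mathcal Y)$. Let $\sigma_j,d_j$ be deterministic vectors (the values used for the standard deviations of $\Phi$ under $p_j$ and for the changes), with $0<\sigma_j^{(i)}\le M$, and put $$\tau_j=\frac1{n_j}\sum_{i=1}^{n_j}\Phi(x_{j,i},y_{j,i}),\qquad s_j=\frac{\sigma_j^2}{n_j}.$$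 The forward vectors are $\tau_1^{\rightharpoonup}=\tau_1$, $s_1^{\rightharpoonup}=s_1$ and, for $2\le j\le k$, $$\tau_j^{\rightharpoonup}=\tau_j+\frac{s_j}{s_{j-1}^{\rightharpoonup}+s_j+d_j^2}(\tau_{j-1}^{\rightharpoonup}-\tau_j),\qquad s_j^{\rightharpoonup}=\Big(\frac1{s_j}+\frac1{s_{j-1}^{\rightharpoonup}+d_j^2}\Big)^{-1}.$$ The backward vectors $\tau_j^{\leftharpoondown k},s_j^{\leftharpoondown k}$ are $\tau_k^{\leftharpoondown k}=\tau_k$, $s_k^{\leftharpoondown k}=s_k$ and, for $j<k$, are given by the same formulas with $\tau_{j+1}^{\leftharpoondown k},s_{j+1}^{\leftharpoondown k},d_{j+1}^2$ in place of $\tau_{j-1}^{\rightharpoonup},s_{j-1}^{\rightharpoonup},d_j^2$. The forward and backward vectors are $\tau_k^{\rightleftharpoons k}=\tau_k^{\rightharpoonup}$, $s_k^{\rightleftharpoons k}=s_k^{\rightharpoonup}$ and, for $j<k$, $$\tau_j^{\rightleftharpoons k}=\tau_j^{\rightharpoonup}+\frac{s_j^{\rightharpoonup}}{s_j^{\rightharpoonup}+s_{j+1}^{\leftharpoondown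 k}+d_{j+1}^2}(\tau_{j+1}^{\leftharpoondown k}-\tau_j^{\rightharpoonup}),\qquad s_j^{\rightleftharpoons k}=\Big(\frac1{s_j^{\rightharpoonup}}+\frac1{s_{j+1}^{\leftharpoondown k}+d_{j+1}^2}\Big)^{-1}.$$ Let $\mathcal U_j^{\rightharpoonup}=\mathcal U(\tau_j^{\rightharpoonup},\sqrt{s_j^{\rightharpoonup}})$ and $\mathcal U_j^{\rightleftharpoons k}=\mathcal U(\tau_j^{\rightleftharpoons k},\sqrt{s_j^{\rightleftharpoons k}})$. A random variable $Z$ is sub-Gaussian with parameter at most $\eta\ge 0$ if $\mathbb E e^{t(Z-\mathbb EZ)}\le e^{\eta^2t^2/2}$ for all $t\in\mathbb R$. Let $\kappa$ be such that, for every component $i$, almost surely $\Phi^{(i)}$ is sub-Gaussian under $p_j$ with parameter at most $\kappa\sigma_j^{(i)}$ ($1\le j\le k$), and $w_j^{(i)}$ is sub-Gaussian with parameter at most $\kappa d_j^{(i)}$ ($2\le j\le k$). **Theorem.** There are effective sample sizes $n_j^{\rightharpoonup},n_j^{\leftharpoondown k},n_j^{\rightleftharpoons k}$ with - $n_1^{\rightharpoonup}=n_1$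 and $n_j^{\rightharpoonup}\ge n_j+n_{j-1}^{\rightharpoonup}\frac{\|\sigma_j^2\|_\infty}{\|\sigma_j^2\|_\infty+n_{j-1}^{\rightharpoonup}\|d_j^2\|_\infty}$ for $2\le j\le k$; - $n_k^{\leftharpoondown k}=n_k$ and $n_j^{\leftharpoondown k}\ge n_j+n_{j+1}^{\leftharpoondown k}\frac{\|\sigma_j^2\|_\infty}{\|\sigma_j^2\|_\infty+n_{j+1}^{\leftharpoondown k}\|d_{j+1}^2\|_\infty}$ for $1\le j\le k-1$; - $n_k^{\rightleftharpoons k}=n_k^{\rightharpoonup}$ and $n_j^{\rightleftharpoons k}\ge n_j^{\rightharpoonup}+n_{j+1}^{\leftharpoondown k}\frac{\|\sigma_j^2\|_\infty}{\|\sigma_j^2\|_\infty+n_{j+1}^{\leftharpoondown k}\|d_{j+1}^2\|_\infty}$ for $1\le j\le k-1$; such that for every $\delta\in(0,1)$ and every $j\in\{1,\dots,k\}$, with probability at least $1-\delta$, $$R(\mathcal U_j^{\rightleftharpoons k})\le R_j^\infty+\frac{M(\kappa+1)\sqrt{2\log(2m/\delta)}}{\sqrt{n_j^{\rightleftharpoons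 k}}}\,\|\mu_j^\infty\|_1 ,$$ and likewise, with probability at least $1-\delta$, the same bound holds for $R(\mathcal U_j^{\rightharpoonup})$ with $n_j^{\rightharpoonup}$ in place of $n_j^{\rightleftharpoons k}$. -/

import Mathlib

open MeasureTheory ProbabilityTheory

namespace LMRC

noncomputable section

/-! Minimax risk classification with the 0-1 loss.
Instances live in a measurable space `X`, labels in a finite set `Y`, and `Φ x y` is the feature
vector in `ℝ^m`.  Vectors are functions `Fin m → ℝ`; sums, products, quotients and inverses of such
vectors are componentwise and `‖·‖` is the sup norm. -/

/-- A (randomized) classification rule: the label `y` is assigned to the instance `x` with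
probability `prob x y`. -/
structure ClassificationRule (X Y : Type*) [MeasurableSpace X] [Fintype Y] where
  prob : X → Y → ℝ
  nonneg : ∀ x y, 0 ≤ prob x y
  sum_one : ∀ x, ∑ y, prob x y = 1
  measurable_prob : ∀ y, Measurable fun x => prob x y

/-- Expected 0-1 loss (error probability) of the rule `h` under the distribution `q`. -/
def risk {X Y : Type*} [MeasurableSpace X] [Fintype Y] [MeasurableSpace Y]
    (h : ClassificationRule X Y) (q : Measure (X × Y)) : ℝ :=
  ∫ z, (1 - h.prob z.1 z.2) ∂q

/-- Mean vector of the features under the distribution `q`. -/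
def featureMean {X Y : Type*} [MeasurableSpace X] [MeasurableSpace Y] {m : ℕ}
    (Φ : X → Y → Fin m → ℝ) (q : Measure (X × Y)) : Fin m → ℝ :=
  fun i => ∫ z, Φ z.1 z.2 i ∂q

/-- The uncertainty set with mean vector `τ` and confidence vector `l`. -/
def uncertaintySet {X Y : Type*} [MeasurableSpace X] [MeasurableSpace Y] {m : ℕ}
    (Φ : X → Y → Fin m → ℝ) (τ l : Fin m → ℝ) : Set (Measure (X × Y)) :=
  {q | IsProbabilityMeasure q ∧ ∀ i, |featureMean Φ q i - τ i| ≤ l i}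

/-- The minimax risk of a set of distributions.  All risks lie in `[0, 1]`; the supremum over an
empty set of distributions is `0`. -/
def minimaxRisk {X Y : Type*} [MeasurableSpace X] [Fintype Y] [MeasurableSpace Y]
    (U : Set (Measure (X × Y))) : ℝ :=
  ⨅ h : ClassificationRule X Y, ⨆ q : U, risk h q

/-- The objective function of the convex optimization problem that defines the parameters of
minimax risk classifiers. -/
def mrcObjective {X Y : Type*} {m : ℕ}
    (Φ : X → Y → Fin m → ℝ) (τ l μ : Fin m → ℝ) : ℝ :=
  1 - ∑ i, τ i * μ i
    + (⨆ xC : X × {C : Finset Y // C.Nonempty},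
        ((∑ y ∈ xC.2.1, ∑ i, Φ xC.1 y i * μ i) - 1) / (xC.2.1.card : ℝ))
    + ∑ i, l i * |μ i|

/-- `μ` is a parameter of the minimax risk classifier for the mean vector `τ` and the confidence
vector `l`. -/
def IsMRCParameter {X Y : Type*} {m : ℕ}
    (Φ : X → Y → Fin m → ℝ) (τ l μ : Fin m → ℝ) : Prop :=
  ∀ ν : Fin m → ℝ, mrcObjective Φ τ l μ ≤ mrcObjective Φ τ l ν

/-- The random variable `f` is sub-Gaussian with parameter at most `η`:
`E exp (t (f - E f)) ≤ exp (η ^ 2 * t ^ 2 / 2)` for all real `t`. -/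
def SubGaussianLE {Z : Type*} [MeasurableSpace Z] (f : Z → ℝ) (η : ℝ) (q : Measure Z) : Prop :=
  0 ≤ η ∧ HasSubgaussianMGF (fun z => f z - ∫ z', f z' ∂q) (Real.toNNReal (η ^ 2)) q

/-! The evolving task setting. -/

/-- Tasks `1, …, k` with random distributions `p 1, …, p k` on `Z`, whose consecutive changes
`p j - p (j - 1)` (seen as random signed measures) are independent and have zero mean, and sample
sets `D j 0, …, D j (n j - 1)`: given `p 1, …, p k`, all samples are independent and those of
task `j` have distribution `p j`. -/
structure EvolvingTasks {Ω Z : Type*} [MeasurableSpace Ω] [MeasurableSpace Z]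
    (P : Measure Ω) (k : ℕ) (n : ℕ → ℕ) (p : ℕ → Ω → Measure Z) (D : ℕ → ℕ → Ω → Z) :
    Prop where
  isProbabilityMeasure : ∀ j ∈ Finset.Icc 1 k, ∀ ω, IsProbabilityMeasure (p j ω)
  measurable_distribution : ∀ j ∈ Finset.Icc 1 k, Measurable (p j)
  independent_changes :
    iIndepFun (fun (j : Finset.Icc 2 k) (ω : Ω) (A : {A : Set Z // MeasurableSet A}) =>
      (p j ω).real A - (p (j - 1) ω).real A) P
  zero_mean_changes : ∀ j ∈ Finset.Icc 2 k, ∀ A : Set Z, MeasurableSet A →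
    ∫ ω, ((p j ω).real A - (p (j - 1) ω).real A) ∂P = 0
  measurable_sample : ∀ j ∈ Finset.Icc 1 k, ∀ i < n j, Measurable (D j i)
  sample_law : ∀ G : Set Ω,
    MeasurableSet[⨆ j ∈ Finset.Icc 1 k,
      MeasurableSpace.comap (p j) Measure.instMeasurableSpace] G →
    ∀ A : ℕ → ℕ → Set Z, (∀ j i, MeasurableSet (A j i)) →
      P (G ∩ ⋂ j ∈ Finset.Icc 1 k, ⋂ i ∈ Finset.range (n j), D j i ⁻¹' A j i)
        = ∫⁻ ω in G, ∏ j ∈ Finset.Icc 1 k, ∏ i ∈ Finset.range (n j), p j ω (A j i) ∂P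

/-- Single-task mean vectors: sample averages of the features. -/
def sampleMean {X Y : Type*} {m : ℕ} (Φ : X → Y → Fin m → ℝ) (n : ℕ → ℕ)
    (D : ℕ → ℕ → X × Y) (j : ℕ) : Fin m → ℝ :=
  fun i => (1 / (n j : ℝ)) * ∑ l ∈ Finset.range (n j), Φ (D j l).1 (D j l).2 i

/-- Single-task MSE vectors `σ_j² / n_j`. -/
def singleMSE {m : ℕ} (σ : ℕ → Fin m → ℝ) (n : ℕ → ℕ) (j : ℕ) : Fin m → ℝ :=
  fun i => σ j i ^ 2 / (n j : ℝ)

/-- Forward MSE vectors from single-task MSE vectors `s` and change vectors `d`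
(tasks are numbered from `1`). -/
def forwardMSE {m : ℕ} (s d : ℕ → Fin m → ℝ) : ℕ → Fin m → ℝ
  | 0 => s 0
  | 1 => s 1
  | j + 2 => (1 / s (j + 2) + 1 / (forwardMSE s d (j + 1) + d (j + 2) ^ 2))⁻¹

/-- Forward mean vectors from single-task mean vectors `τ` and MSE vectors `s`. -/
def forwardMean {m : ℕ} (τ s d : ℕ → Fin m → ℝ) : ℕ → Fin m → ℝ
  | 0 => τ 0
  | 1 => τ 1
  | j + 2 => τ (j + 2)
      + s (j + 2) / (forwardMSE s d (j + 1) + s (j + 2) + d (j + 2) ^ 2)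
        * (forwardMean τ s d (j + 1) - τ (j + 2))

/-- Backward MSE vectors at step `k`. -/
def backwardMSE {m : ℕ} (s d : ℕ → Fin m → ℝ) (k j : ℕ) : Fin m → ℝ :=
  if j < k then (1 / s j + 1 / (backwardMSE s d k (j + 1) + d (j + 1) ^ 2))⁻¹ else s k
termination_by k - j

/-- Backward mean vectors at step `k`. -/
def backwardMean {m : ℕ} (τ s d : ℕ → Fin m → ℝ) (k j : ℕ) : Fin m → ℝ :=
  if j < k then
    τ j + s j / (backwardMSE s d k (j + 1) + s j + d (j + 1) ^ 2)
      * (backwardMean τ s d k (j + 1) - τ j)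
  else τ k
termination_by k - j

/-- Forward and backward MSE vectors at step `k`. -/
def smoothMSE {m : ℕ} (s d : ℕ → Fin m → ℝ) (k j : ℕ) : Fin m → ℝ :=
  if j < k then
    (1 / forwardMSE s d j + 1 / (backwardMSE s d k (j + 1) + d (j + 1) ^ 2))⁻¹
  else forwardMSE s d k

/-- Forward and backward mean vectors at step `k`. -/
def smoothMean {m : ℕ} (τ s d : ℕ → Fin m → ℝ) (k j : ℕ) : Fin m → ℝ :=
  if j < k then
    forwardMean τ s d j
      + forwardMSE s d j / (forwardMSE s d j + backwardMSE s d k (j + 1) + d (j + 1) ^ 2)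
        * (backwardMean τ s d k (j + 1) - forwardMean τ s d j)
  else forwardMean τ s d k

/-- The risk bound for the uncertainty set with mean vector `τ` and confidence vector `√s`, where
`τinf` is the true mean vector and `N` the effective sample size: for every MRC parameter `μ` of
the uncertainty set `U∞` of distributions with mean vector `τinf`,
`R(U) ≤ R(U∞) + M (κ + 1) √(2 log (2 m / δ)) / √N * ‖μ‖₁`. -/
def RiskBound {X Y : Type*} [MeasurableSpace X] [Fintype Y] [MeasurableSpace Y] {m : ℕ}
    (Φ : X → Y → Fin m → ℝ) (M κ δ : ℝ) (τinf τ s : Fin m → ℝ) (N : ℝ) : Prop :=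
  ∀ μ : Fin m → ℝ, IsMRCParameter Φ τinf 0 μ →
    minimaxRisk (uncertaintySet Φ τ fun i => √(s i)) ≤
      minimaxRisk (uncertaintySet Φ τinf 0)
        + M * (κ + 1) * √(2 * Real.log (2 * m / δ)) / √N * ∑ i, |μ i|

end

end LMRC

open LMRC

/-!
The proof has a deterministic half, on minimax risks, and a probabilistic half, on the errors of the
estimated mean vectors.

*Minimax risks.* For every parameter `μ` the objective function bounds the minimax risk from above
(`minimaxRisk_le_mrcObjective`): a rule `h` with `h(y|x) ≥ Φ(x,y)ᵀμ - c`, where `c` is the supremum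
in the objective function, exists because these lower bounds sum to at most one over every set of
labels. For exact mean vectors the minimal value of the objective function is also a lower bound
(`mrcObjective_le_minimaxRisk`). For this, consider the distributions concentrated at an instance
`x` and uniform on a set `C` of labels; no rule errs with probability less than `1 - 1/|C|` under
such a distribution. The convex hull of the pairs of the mean feature vector and this error
probability is `mixtureSet Φ`. Its heights over `τ` are lower bounds for the minimax risk, and
a hyperplane that separates a higher point over `τ` from the closure of `mixtureSet Φ` yields a
parameter with small objective value. The closure does not exceed the set over `τ`, either because
the set is compact (closed range of the features) or because `τ` is a relative interior point of its
projection (`exists_height_gt_of_mem_closure`). Evaluating the objective function for the estimated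
mean and confidence vectors at the parameter for the exact ones gives the sensitivity bound
`minimaxRisk_le_add`, in terms of the componentwise errors of the estimates.

*Estimation errors.* Each component of the error of a forward (or forward and backward) mean vector
is a linear combination, with deterministic coefficients, of the sampling errors of the tasks and of
the changes between consecutive tasks. The combination weights are those of minimal variance, so the
variance of the combination is exactly the MSE of the recursion (`IsLinearEstimate.combine`).
Given the tasks, the sampling errors are independent and sub-Gaussian; integrating them out first
(`lintegral_mul_prod_eq`) and using the independence of the changes afterwards shows that the error
is sub-Gaussian with parameter `κ √s` (`EvolvingTasks.hasSubgaussianMGF`). A Chernoff bound and a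
union bound over the components give the deviation with high probability, and the MSEs are at most
`M ^ 2 / N` for the effective sample sizes `N` (`combinedMSE_le`).
-/

namespace LMRC

/-! ### Convex sets in finite dimension -/

/-- In finite dimension the convex hull of a compact set is compact: by Carathéodory's theorem it is
a finite union of continuous images of products of simplices with powers of the set. -/
lemma isCompact_convexHull {E : Type*} [NormedAddCommGroup E] [NormedSpace ℝ E]
    [FiniteDimensional ℝ E] {s : Set E} (hs : IsCompact s) : IsCompact (convexHull ℝ s) := by
  have key : convexHull ℝ s = ⋃ n ∈ Finset.range (Module.finrank ℝ E + 2),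
      (fun wz : (Fin n → ℝ) × (Fin n → E) => ∑ i, wz.1 i • wz.2 i) ''
        (stdSimplex ℝ (Fin n) ×ˢ Set.univ.pi fun _ => s) := by
    apply Set.Subset.antisymm
    · intro x hx
      obtain ⟨ι, _, z, w, hz, haff, hw, hw1, hx⟩ := eq_pos_convex_span_of_mem_convexHull hx
      have hcard : Fintype.card ι ≤ Module.finrank ℝ E + 1 :=
        haff.card_le_finrank_succ.trans (Nat.succ_le_succ (Submodule.finrank_le _))
      have e : Fin (Fintype.card ι) ≃ ι := (Fintype.equivFin ι).symm
      simp only [Set.mem_iUnion]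
      refine ⟨Fintype.card ι, Finset.mem_range.2 (by omega), (w ∘ e, z ∘ e),
        ⟨⟨fun i => (hw _).le, ?_⟩, fun i _ => hz ⟨_, rfl⟩⟩, ?_⟩
      · simpa using (e.sum_comp w).trans hw1
      · simpa using (e.sum_comp fun i => w i • z i).trans hx
    · simp only [Set.iUnion_subset_iff]
      rintro n - _ ⟨⟨w, z⟩, ⟨⟨hw, hw1⟩, hz⟩, rfl⟩
      exact (convex_convexHull ℝ s).sum_mem (fun i _ => hw i) hw1
        fun i _ => subset_convexHull ℝ s (hz i trivial)
  rw [key]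
  refine (Finset.range _).isCompact_biUnion fun n _ => ?_
  exact ((isCompact_stdSimplex ℝ (Fin n)).prod (isCompact_univ_pi fun _ => hs)).image
    (by fun_prop)

/-- Over a relative interior point of its projection, the closure of a convex set of bounded height
is not higher than the set itself. -/
lemma exists_height_gt_of_mem_closure {E : Type*} [NormedAddCommGroup E] [NormedSpace ℝ E]
    {K : Set (E × ℝ)} (hK : Convex ℝ K) (h01 : ∀ z ∈ K, 0 ≤ z.2 ∧ z.2 ≤ 1)
    {τ : E} (hτ : τ ∈ intrinsicInterior ℝ (Prod.fst '' K)) {v : ℝ} (hv : (τ, v) ∈ closure K)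
    {ε : ℝ} (hε : 0 < ε) : ∃ t, v - ε < t ∧ (τ, t) ∈ K := by
  obtain ⟨⟨τ', hτ'⟩, hint, rfl⟩ := mem_intrinsicInterior.1 hτ
  obtain ⟨r, hr, hball⟩ := Metric.mem_nhds_iff.1 (mem_interior_iff_mem_nhds.1 hint)
  set c : ℝ := 2 / ε with hc
  have hc0 : 0 < c := by positivity
  obtain ⟨⟨u, t⟩, hut, hdist⟩ := Metric.mem_closure_iff.1 hv (min (ε / 2) (r / c)) (by positivity)
  rw [Prod.dist_eq, max_lt_iff, lt_min_iff, lt_min_iff] at hdist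
  have hu : u ∈ affineSpan ℝ (Prod.fst '' K) := subset_affineSpan ℝ _ ⟨_, hut, rfl⟩
  -- reflect `u` through the base point: the base point lies on the segment from `u` to `z`
  set z : E := AffineMap.lineMap τ' u (-c) with hz
  have hzspan : z ∈ affineSpan ℝ (Prod.fst '' K) := AffineMap.lineMap_mem (-c) hτ' hu
  have hzK : z ∈ Prod.fst '' K := by
    refine hball (show (⟨z, hzspan⟩ : affineSpan ℝ (Prod.fst '' K)) ∈ _ from ?_)
    rw [Metric.mem_ball, Subtype.dist_eq]
    simp only [hz, dist_lineMap_left, norm_neg, Real.norm_eq_abs, abs_of_pos hc0]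
    have := hdist.1.2
    rwa [lt_div_iff₀ hc0, mul_comm] at this
  obtain ⟨⟨z', t'⟩, hzt, hz'⟩ := hzK
  have hmem := hK hut hzt (a := c / (1 + c)) (b := 1 / (1 + c)) (by positivity) (by positivity)
    (by field_simp; ring)
  refine ⟨c / (1 + c) * t + 1 / (1 + c) * t', ?_, ?_⟩
  · have h1 := (h01 _ hut).2
    have h2 := (h01 _ hzt).1
    have h3 : v - t < ε / 2 := (le_abs_self _).trans_lt hdist.2.1
    have h4 : 1 / (1 + c) ≤ ε / 2 := by
      rw [hc, div_le_iff₀ (by positivity)]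
      field_simp
      linarith
    have h5 : c / (1 + c) = 1 - 1 / (1 + c) := by field_simp; ring
    have h6 : 0 < 1 / (1 + c) := by positivity
    simp only at h1 h2
    rw [h5]
    nlinarith [mul_nonneg h6.le h2, mul_le_mul_of_nonneg_left h1 h6.le]
  · convert hmem using 1
    simp only at hz'
    ext1
    · simp only [hz', hz, Prod.fst_add, Prod.smul_fst, AffineMap.lineMap_apply_module]
      rw [smul_add, smul_smul, smul_smul, add_comm, add_assoc, ← add_smul]
      have e1 : 1 / (1 + c) * (1 - -c) = 1 := by field_simp; ring
      have e2 : 1 / (1 + c) * -c + c / (1 + c) = 0 := by field_simp; ring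
      rw [e1, e2]; simp
    · simp

/-! ### The optimization problem over the parameters -/

section Mixtures

variable {X Y : Type*} {m : ℕ} {Φ : X → Y → Fin m → ℝ} {M : ℝ}

lemma abs_sum_mul_le {a μ : Fin m → ℝ} (ha : ∀ i, |a i| ≤ M) :
    |∑ i, a i * μ i| ≤ M * ∑ i, |μ i| := by
  rw [Finset.mul_sum]
  refine (Finset.abs_sum_le_sum_abs _ _).trans (Finset.sum_le_sum fun i _ => ?_)
  rw [abs_mul]
  exact mul_le_mul_of_nonneg_right (ha i) (abs_nonneg _)

/-- The supremum in the objective function is that of a bounded family. -/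
lemma bddAbove_mrcObjective (hM : ∀ x y i, |Φ x y i| ≤ M) (μ : Fin m → ℝ) :
    BddAbove (Set.range fun xC : X × {C : Finset Y // C.Nonempty} =>
        ((∑ y ∈ xC.2.1, ∑ i, Φ xC.1 y i * μ i) - 1) / (xC.2.1.card : ℝ)) := by
  refine ⟨M * ∑ i, |μ i|, ?_⟩
  rintro _ ⟨⟨x, C, hC⟩, rfl⟩
  have hpos : (0 : ℝ) < C.card := by exact_mod_cast hC.card_pos
  simp only
  rw [div_le_iff₀ hpos]
  have : ∑ y ∈ C, ∑ i, Φ x y i * μ i ≤ ∑ _y ∈ C, M * ∑ i, |μ i| :=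
    Finset.sum_le_sum fun y _ => (le_abs_self _).trans (abs_sum_mul_le (hM x y))
  rw [Finset.sum_const, nsmul_eq_mul] at this
  linarith

/-- The mean feature vector, and the error probability of an optimal guess, for the distribution
that is concentrated at the instance `x` and uniform on the set `C` of labels. -/
noncomputable def uniformPoint (Φ : X → Y → Fin m → ℝ) (x : X) (C : Finset Y) :
    (Fin m → ℝ) × ℝ :=
  ((C.card : ℝ)⁻¹ • ∑ y ∈ C, Φ x y, 1 - (C.card : ℝ)⁻¹)

/-- The convex hull of the points `uniformPoint Φ x C`: the mean feature vectors and the error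
probabilities attained by mixtures of finitely many such distributions. -/
noncomputable def mixtureSet (Φ : X → Y → Fin m → ℝ) : Set ((Fin m → ℝ) × ℝ) :=
  convexHull ℝ (Set.range fun xC : X × {C : Finset Y // C.Nonempty} => uniformPoint Φ xC.1 xC.2)

lemma mixtureSet_height {z : (Fin m → ℝ) × ℝ} (hz : z ∈ mixtureSet Φ) : 0 ≤ z.2 ∧ z.2 ≤ 1 := by
  have : mixtureSet Φ ⊆ Prod.snd ⁻¹' Set.Icc (0 : ℝ) 1 := by
    refine convexHull_min ?_
      ((convex_Icc (0 : ℝ) 1).linear_preimage (LinearMap.snd ℝ (Fin m → ℝ) ℝ))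
    rintro _ ⟨⟨x, C, hC⟩, rfl⟩
    have h1 : (1 : ℝ) ≤ C.card := by exact_mod_cast hC.card_pos
    have h2 : (C.card : ℝ)⁻¹ ≤ 1 := inv_le_one_of_one_le₀ h1
    have h3 : (0 : ℝ) ≤ (C.card : ℝ)⁻¹ := by positivity
    constructor <;> simp only [uniformPoint] <;> linarith
  exact this hz

lemma fst_image_mixtureSet :
    Prod.fst '' mixtureSet Φ = convexHull ℝ (Set.range fun z : X × Y => Φ z.1 z.2) := by
  have e := (LinearMap.fst ℝ (Fin m → ℝ) ℝ).image_convexHull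
    (Set.range fun xC : X × {C : Finset Y // C.Nonempty} => uniformPoint Φ xC.1 xC.2)
  rw [LinearMap.coe_fst] at e
  rw [mixtureSet, e]
  apply Set.Subset.antisymm
  · refine convexHull_min ?_ (convex_convexHull ℝ _)
    rintro _ ⟨_, ⟨⟨x, C, hC⟩, rfl⟩, rfl⟩
    have hpos : (C.card : ℝ) ≠ 0 := by exact_mod_cast hC.card_pos.ne'
    simp only [uniformPoint, Finset.smul_sum]
    refine (convex_convexHull ℝ _).sum_mem (fun y _ => by positivity) ?_ fun y _ =>
      subset_convexHull ℝ _ ⟨(x, y), rfl⟩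
    rw [Finset.sum_const, nsmul_eq_mul, mul_inv_cancel₀ hpos]
  · refine convexHull_mono ?_
    rintro _ ⟨⟨x, y⟩, rfl⟩
    exact ⟨_, ⟨(x, ⟨{y}, Finset.singleton_nonempty y⟩), rfl⟩, by simp [uniformPoint]⟩

/-- A hyperplane that separates `(τ, v)` from `mixtureSet Φ` is not vertical, and its slope is a
parameter whose objective value is at most `v`. -/
lemma exists_mrcObjective_le [Nonempty X] [Nonempty Y] {τ : Fin m → ℝ} {t v : ℝ}
    (ht : (τ, t) ∈ mixtureSet Φ) (htv : t ≤ v) (hv : (τ, v) ∉ closure (mixtureSet Φ)) :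
    ∃ μ, mrcObjective Φ τ 0 μ ≤ v := by
  obtain ⟨f, u, hfu, hfv⟩ := geometric_hahn_banach_closed_point
    (convex_convexHull ℝ _).closure isClosed_closure hv
  have hsplit : ∀ (a : Fin m → ℝ) (s : ℝ),
      f (a, s) = ∑ i, a i * f (Pi.single i 1, 0) + s * f (0, 1) := by
    intro a s
    have e : (a, s) = ∑ i, a i • ((Pi.single i 1, 0) : (Fin m → ℝ) × ℝ) + s • (0, 1) := by
      ext j
      · simp [Prod.fst_sum, Finset.sum_apply, Pi.single_apply]
      · simp [Prod.snd_sum]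
    rw [e, map_add, map_sum, map_smul]
    simp only [map_smul, smul_eq_mul]
  set b := f (0, 1)
  have hb : 0 < b := by
    have h1 := (hfu _ (subset_closure ht)).trans hfv
    rw [hsplit, hsplit] at h1
    nlinarith
  refine ⟨fun i => f (Pi.single i 1, 0) / b, ?_⟩
  have hsup : (⨆ xC : X × {C : Finset Y // C.Nonempty},
      ((∑ y ∈ xC.2.1, ∑ i, Φ xC.1 y i * (f (Pi.single i 1, 0) / b)) - 1) / (xC.2.1.card : ℝ))
      ≤ ∑ i, τ i * (f (Pi.single i 1, 0) / b) + v - 1 := by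
    have : Nonempty {C : Finset Y // C.Nonempty} :=
      ⟨⟨{Classical.arbitrary Y}, Finset.singleton_nonempty _⟩⟩
    refine ciSup_le ?_
    rintro ⟨x, C, hC⟩
    have hpos : (0 : ℝ) < C.card := by exact_mod_cast hC.card_pos
    have h1 := (hfu _ (subset_closure (subset_convexHull ℝ _ ⟨(x, ⟨C, hC⟩), rfl⟩))).trans hfv
    simp only [uniformPoint] at h1
    rw [hsplit, hsplit] at h1
    have e1 : ∑ i, ((C.card : ℝ)⁻¹ • ∑ y ∈ C, Φ x y) i * f (Pi.single i 1, 0)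
        = b * ((∑ y ∈ C, ∑ i, Φ x y i * (f (Pi.single i 1, 0) / b)) / C.card) := by
      rw [Finset.sum_comm, Finset.sum_div, Finset.mul_sum]
      refine Finset.sum_congr rfl fun i _ => ?_
      rw [← Finset.sum_mul, Pi.smul_apply, Finset.sum_apply, smul_eq_mul, mul_div_assoc',
        mul_div_assoc', mul_comm b, div_mul_cancel₀ _ hb.ne']
      ring
    have e2 : ∑ i, τ i * f (Pi.single i 1, 0) = b * ∑ i, τ i * (f (Pi.single i 1, 0) / b) := by
      rw [Finset.mul_sum]
      exact Finset.sum_congr rfl fun i _ => by field_simp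
    rw [e1, e2] at h1
    have h2 : b * ((∑ y ∈ C, ∑ i, Φ x y i * (f (Pi.single i 1, 0) / b)) / C.card
        + (1 - (C.card : ℝ)⁻¹)) < b * (∑ i, τ i * (f (Pi.single i 1, 0) / b) + v) := by
      linarith
    have h3 := lt_of_mul_lt_mul_left h2 hb.le
    change (∑ y ∈ C, ∑ i, Φ x y i * (f (Pi.single i 1, 0) / b) - 1) / (C.card : ℝ) ≤ _
    rw [sub_div, one_div]
    linarith
  simp only [mrcObjective, Pi.zero_apply, zero_mul, Finset.sum_const_zero]
  linarith

lemma isCompact_range_of_isClosed [Fintype Y] (hM : ∀ x y i, |Φ x y i| ≤ M)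
    (hcl : IsClosed (Set.range Φ)) :
    IsCompact (Set.range Φ) := by
  refine Metric.isCompact_of_isClosed_isBounded hcl
    (isBounded_iff_forall_norm_le.2 ⟨|M|, ?_⟩)
  rintro _ ⟨x, rfl⟩
  exact (pi_norm_le_iff_of_nonneg (abs_nonneg M)).2 fun y =>
    (pi_norm_le_iff_of_nonneg (abs_nonneg M)).2 fun i => (hM x y i).trans (le_abs_self M)

lemma isCompact_mixtureSet [Fintype Y] (hS : IsCompact (Set.range Φ)) :
    IsCompact (mixtureSet Φ) := by
  refine isCompact_convexHull ?_
  have : (Set.range fun xC : X × {C : Finset Y // C.Nonempty} => uniformPoint Φ xC.1 xC.2)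
      = ⋃ C : {C : Finset Y // C.Nonempty}, (fun φ : Y → Fin m → ℝ =>
        ((C.1.card : ℝ)⁻¹ • ∑ y ∈ C.1, φ y, 1 - (C.1.card : ℝ)⁻¹)) '' Set.range Φ := by
    ext z
    simp only [Set.mem_range, Prod.exists, Set.mem_iUnion, uniformPoint, Set.mem_image,
      exists_exists_eq_and]
    rw [exists_comm]
  rw [this]
  exact isCompact_iUnion fun C => hS.image (by fun_prop)

end Mixtures

/-! ### Minimax risks -/

section MinimaxRisk

variable {X Y : Type*} [MeasurableSpace X] [Fintype Y]

lemma ClassificationRule.prob_le_one (h : ClassificationRule X Y) (x : X) (y : Y) :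
    h.prob x y ≤ 1 := by
  rw [← h.sum_one x]
  exact Finset.single_le_sum (fun y _ => h.nonneg x y) (Finset.mem_univ y)

/-- A rule with prescribed lower bounds `g x y - c` on its probabilities exists as soon as these
bounds sum to at most `1` over every set of labels. -/
lemma exists_rule [Nonempty Y] {g : X → Y → ℝ} (hg : ∀ y, Measurable fun x => g x y) {c : ℝ}
    (hc : ∀ x (C : Finset Y), C.Nonempty → (∑ y ∈ C, g x y - 1) / (C.card : ℝ) ≤ c) :
    ∃ h : ClassificationRule X Y, ∀ x y, g x y - c ≤ h.prob x y := by
  classical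
  have hsum : ∀ x, ∑ y, max (g x y - c) 0 ≤ 1 := by
    intro x
    have e : ∑ y, max (g x y - c) 0 = ∑ y ∈ Finset.univ.filter fun y => c < g x y, (g x y - c) := by
      rw [Finset.sum_filter]
      refine Finset.sum_congr rfl fun y _ => ?_
      split_ifs with h
      · exact max_eq_left (by linarith)
      · exact max_eq_right (by linarith)
    rw [e]
    set C := Finset.univ.filter fun y => c < g x y
    rcases C.eq_empty_or_nonempty with h | h
    · simp [h]
    · have := hc x C h
      rw [div_le_iff₀ (by exact_mod_cast h.card_pos)] at this
      rw [Finset.sum_sub_distrib, Finset.sum_const, nsmul_eq_mul]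
      linarith
  have hY : (0 : ℝ) < Fintype.card Y := by exact_mod_cast Fintype.card_pos
  -- the missing mass is spread evenly over the labels
  refine ⟨⟨fun x y => max (g x y - c) 0 + (1 - ∑ y, max (g x y - c) 0) / Fintype.card Y,
    fun x y => ?_, fun x => ?_, fun y => ?_⟩, fun x y => ?_⟩
  · have := hsum x
    exact add_nonneg (le_max_right _ _) (div_nonneg (by linarith) hY.le)
  · rw [Finset.sum_add_distrib, Finset.sum_const, nsmul_eq_mul, Finset.card_univ]
    field_simp
    ring
  · have : ∀ y, Measurable fun x => max (g x y - c) 0 :=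
      fun y => ((hg y).sub_const c).max measurable_const
    exact (this y).add
      ((measurable_const.sub (Finset.measurable_sum _ fun y _ => this y)).div_const _)
  · have h1 := le_max_left (g x y - c) 0
    have h2 : 0 ≤ (1 - ∑ y, max (g x y - c) 0) / Fintype.card Y :=
      div_nonneg (by linarith [hsum x]) hY.le
    simp only
    linarith

variable [MeasurableSpace Y]

lemma risk_nonneg (h : ClassificationRule X Y) (q : Measure (X × Y)) : 0 ≤ risk h q :=
  integral_nonneg fun z => sub_nonneg.2 (h.prob_le_one z.1 z.2)

lemma minimaxRisk_nonneg (U : Set (Measure (X × Y))) : 0 ≤ minimaxRisk U :=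
  Real.iInf_nonneg fun h => Real.iSup_nonneg fun q => risk_nonneg h q

lemma bddBelow_worstRisk (U : Set (Measure (X × Y))) :
    BddBelow (Set.range fun h : ClassificationRule X Y => ⨆ q : U, risk h q) :=
  ⟨0, by rintro _ ⟨h, rfl⟩; exact Real.iSup_nonneg fun q => risk_nonneg h q⟩

variable [MeasurableSingletonClass Y] {m : ℕ} {Φ : X → Y → Fin m → ℝ} {M : ℝ}

lemma measurable_uncurry {f : X → Y → ℝ} (hf : ∀ y, Measurable fun x => f x y) :
    Measurable fun z : X × Y => f z.1 z.2 :=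
  measurable_from_prod_countable_left hf

lemma integrable_of_measurable_of_bounded {f : X → Y → ℝ} (hf : ∀ y, Measurable fun x => f x y)
    {M : ℝ} (hM : ∀ x y, |f x y| ≤ M) (q : Measure (X × Y)) [IsFiniteMeasure q] :
    Integrable (fun z : X × Y => f z.1 z.2) q :=
  Integrable.of_bound (measurable_uncurry hf).aestronglyMeasurable M
    (ae_of_all _ fun z => hM z.1 z.2)

lemma ClassificationRule.integrable (h : ClassificationRule X Y) (q : Measure (X × Y))
    [IsFiniteMeasure q] : Integrable (fun z : X × Y => 1 - h.prob z.1 z.2) q := by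
  refine integrable_of_measurable_of_bounded (f := fun x y => 1 - h.prob x y) (M := 1)
    (fun y => (h.measurable_prob y).const_sub 1) (fun x y => ?_) q
  rw [abs_le]
  constructor <;> linarith [h.nonneg x y, h.prob_le_one x y]

lemma risk_le_one (h : ClassificationRule X Y) (q : Measure (X × Y)) [IsProbabilityMeasure q] :
    risk h q ≤ 1 := by
  have := integral_mono (h.integrable q) (integrable_const (1 : ℝ)) fun z => by
    simpa using h.nonneg z.1 z.2
  simpa [risk] using this

/-- Weak duality: the objective function bounds minimax risks from above. -/
lemma minimaxRisk_le_mrcObjective [Nonempty Y]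
    (hΦ : ∀ y i, Measurable fun x => Φ x y i) (hM : ∀ x y i, |Φ x y i| ≤ M)
    (τ l μ : Fin m → ℝ) (hU : (uncertaintySet Φ τ l).Nonempty) :
    minimaxRisk (uncertaintySet Φ τ l) ≤ mrcObjective Φ τ l μ := by
  set c := ⨆ xC : X × {C : Finset Y // C.Nonempty},
        ((∑ y ∈ xC.2.1, ∑ i, Φ xC.1 y i * μ i) - 1) / (xC.2.1.card : ℝ) with hc
  obtain ⟨h, hh⟩ := exists_rule (g := fun x y => ∑ i, Φ x y i * μ i) (c := c)
    (fun y => Finset.measurable_sum _ fun i _ => (hΦ y i).mul_const _)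
    (fun x C hC => le_ciSup (bddAbove_mrcObjective hM μ) (x, ⟨C, hC⟩))
  have hrisk : ∀ q ∈ uncertaintySet Φ τ l, risk h q ≤ mrcObjective Φ τ l μ := by
    rintro q ⟨hq, hqτ⟩
    have hint : ∀ i, Integrable (fun z : X × Y => Φ z.1 z.2 i * μ i) q := fun i =>
      (integrable_of_measurable_of_bounded (f := fun x y => Φ x y i) (fun y => hΦ y i)
        (fun x y => hM x y i) q).mul_const _
    have h1 : risk h q ≤ ∫ z : X × Y, ((1 + c) - ∑ i, Φ z.1 z.2 i * μ i) ∂q := by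
      refine integral_mono (h.integrable q)
        ((integrable_const _).sub (integrable_finsetSum _ fun i _ => hint i)) fun z => ?_
      have := hh z.1 z.2
      simp only
      linarith
    rw [integral_sub (integrable_const _) (integrable_finsetSum _ fun i _ => hint i),
      integral_finsetSum _ fun i _ => hint i] at h1
    simp only [integral_const, integral_mul_const, probReal_univ, one_smul] at h1
    have h2 : ∑ i, τ i * μ i - ∑ i, l i * |μ i| ≤ ∑ i, (∫ z : X × Y, Φ z.1 z.2 i ∂q) * μ i := by
      rw [← Finset.sum_sub_distrib]
      refine Finset.sum_le_sum fun i _ => ?_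
      have h3 : -(l i * |μ i|) ≤ (featureMean Φ q i - τ i) * μ i := by
        refine (abs_le.1 ?_).1
        rw [abs_mul]
        exact mul_le_mul_of_nonneg_right (hqτ i) (abs_nonneg _)
      simp only [featureMean] at h3
      linarith
    rw [mrcObjective, ← hc]
    linarith
  obtain ⟨q, hq⟩ := hU
  exact ciInf_le_of_le (bddBelow_worstRisk _) h
    (Real.iSup_le (fun q => hrisk q q.2) ((risk_nonneg h q).trans (hrisk q hq)))

/-- Every point of `mixtureSet Φ` comes from a distribution for which no rule has a smaller error
probability than the second coordinate. -/
lemma exists_measure_of_mem_mixtureSet (hΦ : ∀ y i, Measurable fun x => Φ x y i)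
    (hM : ∀ x y i, |Φ x y i| ≤ M) {z : (Fin m → ℝ) × ℝ} (hz : z ∈ mixtureSet Φ) :
    ∃ q : Measure (X × Y), IsProbabilityMeasure q ∧ featureMean Φ q = z.1 ∧
      ∀ h : ClassificationRule X Y, z.2 ≤ risk h q := by
  refine (convexHull_min (t := {z | ∃ q : Measure (X × Y), IsProbabilityMeasure q ∧
    featureMean Φ q = z.1 ∧ ∀ h : ClassificationRule X Y, z.2 ≤ risk h q}) ?_ ?_) hz
  · rintro _ ⟨⟨x, C, hC⟩, rfl⟩
    have hpos : (C.card : ℝ) ≠ 0 := by exact_mod_cast hC.card_pos.ne'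
    have hpos' : (C.card : ENNReal) ≠ 0 := by exact_mod_cast hC.card_pos.ne'
    set q : Measure (X × Y) := (C.card : ENNReal)⁻¹ • ∑ y ∈ C, Measure.dirac (x, y) with hq
    have hint : ∀ f : X → Y → ℝ, (∀ y, Measurable fun x => f x y) →
        ∫ z, f z.1 z.2 ∂q = (C.card : ℝ)⁻¹ * ∑ y ∈ C, f x y := by
      intro f hf
      have hf' := (measurable_uncurry hf).stronglyMeasurable
      rw [hq, integral_smul_measure, integral_finsetSum_measure]
      · simp [integral_dirac' _ _ hf']
      · intro y _
        exact (integrable_dirac' hf' (by simp))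
    refine ⟨q, ⟨?_⟩, ?_, fun h => ?_⟩
    · simp [hq, ENNReal.inv_mul_cancel hpos' (ENNReal.natCast_ne_top _)]
    · funext i
      rw [featureMean, hint (fun x y => Φ x y i) fun y => hΦ y i]
      simp [uniformPoint]
    · rw [risk, hint (fun x y => 1 - h.prob x y) fun y => (h.measurable_prob y).const_sub 1]
      rw [Finset.sum_sub_distrib, Finset.sum_const, nsmul_eq_mul, mul_one, mul_sub,
        inv_mul_cancel₀ hpos]
      have h1 : ∑ y ∈ C, h.prob x y ≤ 1 := by
        rw [← h.sum_one x]
        exact Finset.sum_le_sum_of_subset_of_nonneg (Finset.subset_univ _) fun y _ _ => h.nonneg x y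
      have h2 : (0 : ℝ) ≤ (C.card : ℝ)⁻¹ := by positivity
      simp only [uniformPoint]
      nlinarith
  · rintro z₁ ⟨q₁, hq₁, hτ₁, h₁⟩ z₂ ⟨q₂, hq₂, hτ₂, h₂⟩ a b ha hb hab
    have hint : ∀ f : X × Y → ℝ, Integrable f q₁ → Integrable f q₂ →
        ∫ z, f z ∂(ENNReal.ofReal a • q₁ + ENNReal.ofReal b • q₂)
          = a * ∫ z, f z ∂q₁ + b * ∫ z, f z ∂q₂ := by
      intro f hf₁ hf₂
      rw [integral_add_measure (hf₁.smul_measure ENNReal.ofReal_ne_top)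
        (hf₂.smul_measure ENNReal.ofReal_ne_top), integral_smul_measure, integral_smul_measure,
        ENNReal.toReal_ofReal ha, ENNReal.toReal_ofReal hb, smul_eq_mul, smul_eq_mul]
    refine ⟨ENNReal.ofReal a • q₁ + ENNReal.ofReal b • q₂, ⟨?_⟩, ?_, fun h => ?_⟩
    · simp [← ENNReal.ofReal_add ha hb, hab]
    · have hi : ∀ (i) (q : Measure (X × Y)) [IsProbabilityMeasure q],
          Integrable (fun z : X × Y => Φ z.1 z.2 i) q := fun i q _ =>
        integrable_of_measurable_of_bounded (f := fun x y => Φ x y i) (fun y => hΦ y i)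
          (fun x y => hM x y i) q
      funext i
      rw [featureMean, hint _ (hi i q₁) (hi i q₂)]
      simp [← hτ₁, ← hτ₂, featureMean]
    · rw [risk, hint _ (h.integrable q₁) (h.integrable q₂)]
      exact add_le_add (mul_le_mul_of_nonneg_left (h₁ h) ha) (mul_le_mul_of_nonneg_left (h₂ h) hb)

/-- The heights of `mixtureSet Φ` over `τ` are lower bounds for the minimax risk. -/
lemma le_minimaxRisk_of_mem_mixtureSet [Nonempty Y] (hΦ : ∀ y i, Measurable fun x => Φ x y i)
    (hM : ∀ x y i, |Φ x y i| ≤ M) {τ : Fin m → ℝ} {t : ℝ} (h : (τ, t) ∈ mixtureSet Φ) :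
    t ≤ minimaxRisk (uncertaintySet Φ τ 0) := by
  classical
  obtain ⟨q, hq, hτ, hr⟩ := exists_measure_of_mem_mixtureSet hΦ hM h
  have : Nonempty (ClassificationRule X Y) :=
    ⟨fun _ y => if y = Classical.arbitrary Y then 1 else 0, fun _ y => by positivity, by simp,
      fun y => measurable_const⟩
  have hqU : q ∈ uncertaintySet Φ τ 0 := ⟨hq, fun i => by simp [hτ]⟩
  refine le_ciInf fun r => (hr r).trans ?_
  refine le_ciSup (f := fun q : uncertaintySet Φ τ 0 => risk r q) ⟨1, ?_⟩ ⟨q, hqU⟩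
  rintro _ ⟨q, rfl⟩
  have := q.2.1
  exact risk_le_one r q

/-- Strong duality for exact mean vectors: the minimal value of the objective function does not
exceed the minimax risk, provided the closure of `mixtureSet Φ` is not higher over `τ` than
`mixtureSet Φ` itself. -/
lemma mrcObjective_le_minimaxRisk [Nonempty X] [Nonempty Y]
    (hΦ : ∀ y i, Measurable fun x => Φ x y i) (hM : ∀ x y i, |Φ x y i| ≤ M) {τ μ : Fin m → ℝ}
    (hτ : τ ∈ Prod.fst '' mixtureSet Φ)
    (hcl : ∀ v, (τ, v) ∈ closure (mixtureSet Φ) → ∀ ε > 0, ∃ t, v - ε < t ∧ (τ, t) ∈ mixtureSet Φ)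
    (hμ : IsMRCParameter Φ τ 0 μ) :
    mrcObjective Φ τ 0 μ ≤ minimaxRisk (uncertaintySet Φ τ 0) := by
  by_contra! hlt
  obtain ⟨⟨τ', t⟩, ht, rfl⟩ := hτ
  obtain ⟨v, hv1, hv2⟩ := exists_between hlt
  have hnot : (τ', v) ∉ closure (mixtureSet Φ) := by
    intro h
    obtain ⟨s, hs, hsK⟩ := hcl v h _ (sub_pos.2 hv1)
    have := le_minimaxRisk_of_mem_mixtureSet hΦ hM hsK
    linarith
  obtain ⟨ν, hν⟩ := exists_mrcObjective_le ht
    ((le_minimaxRisk_of_mem_mixtureSet hΦ hM ht).trans hv1.le) hnot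
  exact absurd ((hμ ν).trans hν) (not_le.2 hv2)

/-- Mean feature vectors belong to the convex hull of the features when the latter is closed. -/
lemma featureMean_mem_convexHull (hΦ : ∀ y i, Measurable fun x => Φ x y i)
    (hM : ∀ x y i, |Φ x y i| ≤ M)
    (hcl : IsClosed (convexHull ℝ (Set.range fun z : X × Y => Φ z.1 z.2)))
    (q : Measure (X × Y)) [IsProbabilityMeasure q] :
    featureMean Φ q ∈ convexHull ℝ (Set.range fun z : X × Y => Φ z.1 z.2) := by
  have hi : ∀ i, Integrable (fun z : X × Y => Φ z.1 z.2 i) q := fun i =>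
    integrable_of_measurable_of_bounded (f := fun x y => Φ x y i) (fun y => hΦ y i)
      (fun x y => hM x y i) q
  have := (convex_convexHull ℝ (Set.range fun z : X × Y => Φ z.1 z.2)).integral_mem (μ := q) hcl
    (f := fun z => Φ z.1 z.2) (ae_of_all _ fun z => subset_convexHull ℝ _ ⟨z, rfl⟩)
    (Integrable.of_eval hi)
  convert this using 1
  funext i
  rw [eval_integral hi, featureMean]

/-- Sensitivity of the minimax risk: replacing the exact mean vector of a distribution `q` by an
estimate `τ` with confidence vector `l` increases the minimax risk at most by the weighted `ℓ¹` norm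
of the parameter, with weights `|τ - τ∞| + l`. -/
theorem minimaxRisk_le_add [Nonempty X] [Nonempty Y]
    (hΦ : ∀ y i, Measurable fun x => Φ x y i) (hM : ∀ x y i, |Φ x y i| ≤ M)
    (q : Measure (X × Y)) [IsProbabilityMeasure q]
    (hreg : IsClosed (Set.range Φ) ∨ featureMean Φ q ∈
      intrinsicInterior ℝ (convexHull ℝ (Set.range fun z : X × Y => Φ z.1 z.2)))
    {τ l μ : Fin m → ℝ} (hl : ∀ i, 0 ≤ l i) (hμ : IsMRCParameter Φ (featureMean Φ q) 0 μ) :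
    minimaxRisk (uncertaintySet Φ τ l) ≤ minimaxRisk (uncertaintySet Φ (featureMean Φ q) 0)
      + ∑ i, (|τ i - featureMean Φ q i| + l i) * |μ i| := by
  set τi := featureMean Φ q with hτi
  have hstrong : mrcObjective Φ τi 0 μ ≤ minimaxRisk (uncertaintySet Φ τi 0) := by
    rcases hreg with h | h
    · have hK := isCompact_mixtureSet (isCompact_range_of_isClosed hM h)
      refine mrcObjective_le_minimaxRisk hΦ hM ?_ ?_ hμ
      · rw [fst_image_mixtureSet]
        refine featureMean_mem_convexHull hΦ hM ?_ q
        rw [← fst_image_mixtureSet]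
        exact (hK.image continuous_fst).isClosed
      · intro v hv ε hε
        rw [hK.isClosed.closure_eq] at hv
        exact ⟨v, by linarith, hv⟩
    · rw [← fst_image_mixtureSet] at h
      exact mrcObjective_le_minimaxRisk hΦ hM (intrinsicInterior_subset h) (fun v hv ε hε =>
        exists_height_gt_of_mem_closure (convex_convexHull ℝ _) (fun _ => mixtureSet_height) h hv
          hε) hμ
  have hnn : 0 ≤ ∑ i, (|τ i - τi i| + l i) * |μ i| :=
    Finset.sum_nonneg fun i _ => mul_nonneg (add_nonneg (abs_nonneg _) (hl i)) (abs_nonneg _)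
  rcases (uncertaintySet Φ τ l).eq_empty_or_nonempty with hU | hU
  -- the supremum over an empty uncertainty set is `0`
  · have : minimaxRisk (uncertaintySet Φ τ l) = 0 := by
      rw [hU, minimaxRisk]
      simp [Real.iSup_of_isEmpty]
    rw [this]
    exact add_nonneg (minimaxRisk_nonneg _) hnn
  · refine (minimaxRisk_le_mrcObjective hΦ hM τ l μ hU).trans ?_
    refine le_trans ?_ (add_le_add_left hstrong _)
    have : ∑ i, τi i * μ i - ∑ i, τ i * μ i ≤ ∑ i, |τ i - τi i| * |μ i| := by
      rw [← Finset.sum_sub_distrib]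
      refine Finset.sum_le_sum fun i _ => ?_
      rw [← abs_mul, ← sub_mul, ← abs_neg]
      exact (le_abs_self _).trans_eq (by ring_nf)
    simp only [mrcObjective, add_mul, Finset.sum_add_distrib, Pi.zero_apply, zero_mul,
      Finset.sum_const_zero]
    linarith

end MinimaxRisk

/-! ### Conditionally independent samples -/

/-- Given a σ-algebra `𝓖` and variables `D i` that are independent with distributions `p i` given
`𝓖` (a property stated for measurable boxes), expectations of products of nonnegative functions of
the variables, weighted by a `𝓖`-measurable function, are computed by integrating out each variable
separately. -/
lemma lintegral_mul_prod_eq {ι Ω Z : Type*} [MeasurableSpace Z] {𝓖 mΩ : MeasurableSpace Ω}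
    {P : Measure Ω} (h𝓖 : 𝓖 ≤ mΩ) (S : Finset ι) {p : ι → Ω → Measure Z}
    (hp : ∀ i ∈ S, Measurable[𝓖] (p i)) {D : ι → Ω → Z} (hD : ∀ i ∈ S, Measurable (D i))
    (hlaw : ∀ G : Set Ω, MeasurableSet[𝓖] G → ∀ A : ι → Set Z, (∀ i, MeasurableSet (A i)) →
      P (G ∩ ⋂ i ∈ S, D i ⁻¹' A i) = ∫⁻ ω in G, ∏ i ∈ S, p i ω (A i) ∂P)
    {F : Ω → ENNReal} (hF : Measurable[𝓖] F) {g : ι → Z → ENNReal} (hg : ∀ i, Measurable (g i)) :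
    ∫⁻ ω, F ω * ∏ i ∈ S, g i (D i ω) ∂P = ∫⁻ ω, F ω * ∏ i ∈ S, ∫⁻ z, g i z ∂(p i ω) ∂P := by
  classical
  have hp' : ∀ i ∈ S, Measurable (p i) := fun i hi => (hp i hi).mono h𝓖 le_rfl
  have hF' : Measurable F := hF.mono h𝓖 le_rfl
  have box : ∀ A : ι → Set Z, (∀ i, MeasurableSet (A i)) →
      ∫⁻ ω, F ω * ∏ i ∈ S, (A i).indicator 1 (D i ω) ∂P
        = ∫⁻ ω, F ω * ∏ i ∈ S, p i ω (A i) ∂P := by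
    intro A hA
    have hB : MeasurableSet (⋂ i ∈ S, D i ⁻¹' A i) :=
      Finset.measurableSet_biInter _ fun i hi => hD i hi (hA i)
    have hprod : Measurable fun ω => ∏ i ∈ S, p i ω (A i) :=
      Finset.measurable_prod _ fun i hi => (Measure.measurable_coe (hA i)).comp (hp' i hi)
    have heq : (P.restrict (⋂ i ∈ S, D i ⁻¹' A i)).trim h𝓖
        = (P.withDensity fun ω => ∏ i ∈ S, p i ω (A i)).trim h𝓖 := by
      refine @Measure.ext _ 𝓖 _ _ fun G hG => ?_
      rw [trim_measurableSet_eq h𝓖 hG, trim_measurableSet_eq h𝓖 hG,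
        Measure.restrict_apply (h𝓖 _ hG), withDensity_apply _ (h𝓖 _ hG), hlaw G hG A hA]
    calc ∫⁻ ω, F ω * ∏ i ∈ S, (A i).indicator 1 (D i ω) ∂P
        = ∫⁻ ω, (⋂ i ∈ S, D i ⁻¹' A i).indicator F ω ∂P := by
          refine lintegral_congr fun ω => ?_
          have e : ∏ i ∈ S, (A i).indicator (1 : Z → ENNReal) (D i ω)
              = (⋂ i ∈ S, D i ⁻¹' A i).indicator 1 ω := by
            have := prod_indicator_const_apply S (fun i => D i ⁻¹' A i)
              (1 : Ω → ENNReal) ω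
            rw [one_pow] at this
            rw [← this]
            rfl
          rw [e]
          by_cases h : ω ∈ ⋂ i ∈ S, D i ⁻¹' A i <;> simp [h, -Set.mem_iInter]
      _ = ∫⁻ ω, F ω ∂(P.restrict (⋂ i ∈ S, D i ⁻¹' A i)) := lintegral_indicator hB F
      _ = ∫⁻ ω, F ω ∂(P.withDensity fun ω => ∏ i ∈ S, p i ω (A i)) := by
          rw [← lintegral_trim h𝓖 hF, heq, lintegral_trim h𝓖 hF]
      _ = ∫⁻ ω, F ω * ∏ i ∈ S, p i ω (A i) ∂P := by
          rw [lintegral_withDensity_eq_lintegral_mul _ hprod hF']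
          simp only [Pi.mul_apply, mul_comm]
  -- indicators are replaced by arbitrary functions one variable at a time
  have main : ∀ T ⊆ S, ∀ g : ι → Z → ENNReal, (∀ i, Measurable (g i)) →
      (∀ i ∉ T, ∃ A, MeasurableSet A ∧ g i = A.indicator 1) →
      ∫⁻ ω, F ω * ∏ i ∈ S, g i (D i ω) ∂P
        = ∫⁻ ω, F ω * ∏ i ∈ S, ∫⁻ z, g i z ∂(p i ω) ∂P := by
    intro T
    induction T using Finset.induction_on with
    | empty =>
      intro _ g _ hind
      choose A hA hgA using fun i => hind i (Finset.notMem_empty i)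
      simp only [hgA, lintegral_indicator_one (hA _)]
      exact box A hA
    | insert a T haT ih =>
      intro hTS g hg hind
      have haS : a ∈ S := hTS (Finset.mem_insert_self a T)
      have hTS' : T ⊆ S := (Finset.subset_insert a T).trans hTS
      have hm₁ : Measurable fun ω => F ω * ∏ i ∈ S.erase a, g i (D i ω) :=
        hF'.mul (Finset.measurable_prod _ fun i hi =>
          (hg i).comp (hD i (Finset.mem_of_mem_erase hi)))
      have hm₂ : Measurable fun ω => F ω * ∏ i ∈ S.erase a, ∫⁻ z, g i z ∂(p i ω) :=
        hF'.mul (Finset.measurable_prod _ fun i hi =>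
          (Measure.measurable_lintegral (hg i)).comp (hp' i (Finset.mem_of_mem_erase hi)))
      set ν₁ : Measure Z :=
        (P.withDensity fun ω => F ω * ∏ i ∈ S.erase a, g i (D i ω)).map (D a)
      set ν₂ : Measure Z :=
        (P.withDensity fun ω => F ω * ∏ i ∈ S.erase a, ∫⁻ z, g i z ∂(p i ω)).bind (p a)
      have h₁ : ∀ f : Z → ENNReal, Measurable f → ∫⁻ z, f z ∂ν₁
          = ∫⁻ ω, F ω * ∏ i ∈ S, Function.update g a f i (D i ω) ∂P := by
        intro f hf
        rw [lintegral_map hf (hD a haS),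
          lintegral_withDensity_eq_lintegral_mul _ hm₁ (g := fun ω => f (D a ω))
            (hf.comp (hD a haS))]
        refine lintegral_congr fun ω => ?_
        rw [← Finset.mul_prod_erase S _ haS, Function.update_self]
        have : ∏ i ∈ S.erase a, Function.update g a f i (D i ω) = ∏ i ∈ S.erase a, g i (D i ω) :=
          Finset.prod_congr rfl fun i hi => by
            rw [Function.update_of_ne (Finset.ne_of_mem_erase hi)]
        rw [this, Pi.mul_apply, mul_assoc, mul_comm (f (D a ω))]
      have h₂ : ∀ f : Z → ENNReal, Measurable f → ∫⁻ z, f z ∂ν₂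
          = ∫⁻ ω, F ω * ∏ i ∈ S, ∫⁻ z, Function.update g a f i z ∂(p i ω) ∂P := by
        intro f hf
        rw [Measure.lintegral_bind (hp' a haS).aemeasurable hf.aemeasurable,
          lintegral_withDensity_eq_lintegral_mul _ hm₂ (g := fun ω => ∫⁻ z, f z ∂(p a ω))
            ((Measure.measurable_lintegral hf).comp (hp' a haS))]
        refine lintegral_congr fun ω => ?_
        rw [← Finset.mul_prod_erase S _ haS, Function.update_self]
        have : ∏ i ∈ S.erase a, ∫⁻ z, Function.update g a f i z ∂(p i ω)
            = ∏ i ∈ S.erase a, ∫⁻ z, g i z ∂(p i ω) :=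
          Finset.prod_congr rfl fun i hi => by
            rw [Function.update_of_ne (Finset.ne_of_mem_erase hi)]
        rw [this, Pi.mul_apply, mul_assoc, mul_comm (∫⁻ z, f z ∂(p a ω))]
      have heq : ν₁ = ν₂ := by
        refine Measure.ext fun B hB => ?_
        have hB1 : Measurable (B.indicator (1 : Z → ENNReal)) := measurable_one.indicator hB
        rw [← lintegral_indicator_one hB, ← lintegral_indicator_one hB, h₁ _ hB1, h₂ _ hB1]
        refine ih hTS' _ (fun i => ?_) fun i hi => ?_
        · rcases eq_or_ne i a with rfl | hia
          · rwa [Function.update_self]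
          · rw [Function.update_of_ne hia]
            exact hg i
        · rcases eq_or_ne i a with rfl | hia
          · exact ⟨B, hB, Function.update_self ..⟩
          · rw [Function.update_of_ne hia]
            exact hind i (by simp [hia, hi])
      have e₁ := h₁ (g a) (hg a)
      have e₂ := h₂ (g a) (hg a)
      rw [Function.update_eq_self] at e₁ e₂
      rw [← e₁, ← e₂, heq]
  have := main S subset_rfl (fun i => if i ∈ S then g i else (∅ : Set Z).indicator 1)
    (fun i => by split_ifs; exacts [hg i, measurable_one.indicator MeasurableSet.empty])
    (fun i hi => ⟨∅, MeasurableSet.empty, by simp [hi]⟩)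
  have e : ∀ i ∈ S, (if i ∈ S then g i else (∅ : Set Z).indicator 1) = g i := fun i hi => if_pos hi
  convert this using 2
  · funext ω
    exact congrArg _ (Finset.prod_congr rfl fun i hi => by rw [e i hi])
  · funext ω
    exact congrArg _ (Finset.prod_congr rfl fun i hi => by rw [e i hi])

/-! ### Integrals against random distributions -/

section RandomDistributions

variable {Ω Z : Type*} [MeasurableSpace Z] {f : Z → ℝ} {M : ℝ}

/-- For a simple function, the change of the expectation is a finite linear combination of changes
of probabilities. -/
lemma simpleFunc_integral_sub (φ : SimpleFunc Z ℝ) (q₁ q₂ : Measure Z)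
    [IsProbabilityMeasure q₁] [IsProbabilityMeasure q₂] :
    ∫ z, φ z ∂q₁ - ∫ z, φ z ∂q₂
      = ∑ r ∈ φ.range, (q₁.real (φ ⁻¹' {r}) - q₂.real (φ ⁻¹' {r})) * r := by
  rw [← SimpleFunc.integral_eq_integral φ (SimpleFunc.integrable_of_isFiniteMeasure φ),
    ← SimpleFunc.integral_eq_integral φ (SimpleFunc.integrable_of_isFiniteMeasure φ),
    SimpleFunc.integral_eq, SimpleFunc.integral_eq, ← Finset.sum_sub_distrib]
  simp [sub_mul]

lemma tendsto_integral_approxBounded (hf : StronglyMeasurable f) (hM0 : 0 ≤ M)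
    (hM : ∀ z, ‖f z‖ ≤ M) (q : Measure Z) [IsProbabilityMeasure q] :
    Filter.Tendsto (fun n => ∫ z, hf.approxBounded M n z ∂q) Filter.atTop
      (nhds (∫ z, f z ∂q)) :=
  tendsto_integral_of_dominated_convergence (fun _ => M)
    (fun _ => (SimpleFunc.stronglyMeasurable _).aestronglyMeasurable) (integrable_const M)
    (fun _ => ae_of_all _ fun z => hf.norm_approxBounded_le hM0 _ z)
    (ae_of_all _ fun z => hf.tendsto_approxBounded_of_norm_le (hM z))

/-- The change of the expectation of a bounded function is a function of the change of the
distribution. -/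
lemma measurable_integral_sub (hf : Measurable f) (hM : ∀ z, |f z| ≤ M) {q₁ q₂ : Ω → Measure Z}
    (h₁ : ∀ ω, IsProbabilityMeasure (q₁ ω)) (h₂ : ∀ ω, IsProbabilityMeasure (q₂ ω)) :
    Measurable[MeasurableSpace.comap (fun (ω : Ω) (A : {A : Set Z // MeasurableSet A}) =>
      (q₁ ω).real A - (q₂ ω).real A) inferInstance]
      fun ω => ∫ z, f z ∂(q₁ ω) - ∫ z, f z ∂(q₂ ω) := by
  rcases isEmpty_or_nonempty Z with hZ | ⟨⟨z₀⟩⟩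
  · simp only [integral_of_isEmpty, sub_zero]
    exact measurable_const
  have hM0 : 0 ≤ M := (abs_nonneg _).trans (hM z₀)
  have hfs := hf.stronglyMeasurable
  refine @measurable_of_tendsto_metrizable _ _ (_) _ _ _ _
    (fun n ω => ∫ z, hfs.approxBounded M n z ∂(q₁ ω) - ∫ z, hfs.approxBounded M n z ∂(q₂ ω)) _
    (fun n => ?_) (tendsto_pi_nhds.2 fun ω => ?_)
  · simp only [simpleFunc_integral_sub]
    refine Finset.measurable_sum _ fun r _ => Measurable.mul_const ?_ r
    exact (measurable_pi_apply (X := fun _ : {A : Set Z // MeasurableSet A} => ℝ)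
      ⟨_, (hfs.approxBounded M n).measurableSet_fiber r⟩).comp (comap_measurable _)
  · exact (tendsto_integral_approxBounded hfs hM0 hM _).sub
      (tendsto_integral_approxBounded hfs hM0 hM _)

/-- If the probabilities of all events have the same mean for two random distributions, so have the
expectations of a bounded function. -/
lemma integral_integral_sub_eq_zero [MeasurableSpace Ω] {P : Measure Ω} [IsProbabilityMeasure P]
    (hf : Measurable f) (hM : ∀ z, |f z| ≤ M) {q₁ q₂ : Ω → Measure Z}
    (hq₁ : Measurable q₁) (hq₂ : Measurable q₂)
    (h₁ : ∀ ω, IsProbabilityMeasure (q₁ ω)) (h₂ : ∀ ω, IsProbabilityMeasure (q₂ ω))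
    (h : ∀ A, MeasurableSet A → ∫ ω, ((q₁ ω).real A - (q₂ ω).real A) ∂P = 0) :
    ∫ ω, (∫ z, f z ∂(q₁ ω) - ∫ z, f z ∂(q₂ ω)) ∂P = 0 := by
  rcases isEmpty_or_nonempty Z with hZ | ⟨⟨z₀⟩⟩
  · simp only [integral_of_isEmpty, sub_zero, integral_zero]
  have hM0 : 0 ≤ M := (abs_nonneg _).trans (hM z₀)
  have hfs := hf.stronglyMeasurable
  have hreal : ∀ {q : Ω → Measure Z}, Measurable q → ∀ {A}, MeasurableSet A →
      Measurable fun ω => (q ω).real A := fun hq A hA =>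
    ((Measure.measurable_coe hA).comp hq).ennreal_toReal
  have hmeas : ∀ n, Measurable fun ω =>
      ∫ z, hfs.approxBounded M n z ∂(q₁ ω) - ∫ z, hfs.approxBounded M n z ∂(q₂ ω) := by
    intro n
    simp only [simpleFunc_integral_sub]
    exact Finset.measurable_sum _ fun r _ =>
      ((hreal hq₁ ((hfs.approxBounded M n).measurableSet_fiber r)).sub
        (hreal hq₂ ((hfs.approxBounded M n).measurableSet_fiber r))).mul_const r
  have hbound : ∀ n (q : Measure Z) [IsProbabilityMeasure q],
      ‖∫ z, hfs.approxBounded M n z ∂q‖ ≤ M := fun n q _ => by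
    simpa using norm_integral_le_of_norm_le_const (μ := q)
      (ae_of_all _ fun z => hfs.norm_approxBounded_le hM0 n z)
  have hlim := tendsto_integral_of_dominated_convergence (μ := P) (fun _ => M + M)
    (F := fun n ω => ∫ z, hfs.approxBounded M n z ∂(q₁ ω) - ∫ z, hfs.approxBounded M n z ∂(q₂ ω))
    (f := fun ω => ∫ z, f z ∂(q₁ ω) - ∫ z, f z ∂(q₂ ω))
    (fun n => (hmeas n).aestronglyMeasurable) (integrable_const _)
    (fun n => ae_of_all _ fun ω => (norm_sub_le _ _).trans (add_le_add (hbound n _) (hbound n _)))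
    (ae_of_all _ fun ω => (tendsto_integral_approxBounded hfs hM0 hM _).sub
      (tendsto_integral_approxBounded hfs hM0 hM _))
  refine tendsto_nhds_unique hlim (tendsto_const_nhds.congr fun n => ?_)
  simp only [simpleFunc_integral_sub]
  rw [integral_finsetSum]
  · refine (Finset.sum_eq_zero fun r _ => ?_).symm
    rw [integral_mul_const, h _ ((hfs.approxBounded M n).measurableSet_fiber r), zero_mul]
  · intro r _
    have hA := (hfs.approxBounded M n).measurableSet_fiber r
    refine Integrable.mul_const (Integrable.sub ?_ ?_) r
    · exact Integrable.of_bound (hreal hq₁ hA).aestronglyMeasurable 1 (ae_of_all _ fun ω => by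
        rw [Real.norm_of_nonneg measureReal_nonneg]; exact measureReal_le_one)
    · exact Integrable.of_bound (hreal hq₂ hA).aestronglyMeasurable 1 (ae_of_all _ fun ω => by
        rw [Real.norm_of_nonneg measureReal_nonneg]; exact measureReal_le_one)

end RandomDistributions

/-! ### Sub-Gaussian random variables -/

lemma hasSubgaussianMGF_of_lintegral_le {Ω : Type*} [MeasurableSpace Ω] {P : Measure Ω}
    {X : Ω → ℝ} (hX : AEMeasurable X P) {c : ℝ} (hc : 0 ≤ c)
    (h : ∀ t : ℝ, ∫⁻ ω, ENNReal.ofReal (Real.exp (t * X ω)) ∂P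
      ≤ ENNReal.ofReal (Real.exp (c * t ^ 2 / 2))) :
    HasSubgaussianMGF X c.toNNReal P := by
  have hint : ∀ t : ℝ, Integrable (fun ω => Real.exp (t * X ω)) P := fun t => by
    refine ⟨(hX.const_mul t).exp.aestronglyMeasurable, ?_⟩
    rw [hasFiniteIntegral_iff_ofReal (ae_of_all _ fun ω => (Real.exp_pos _).le)]
    exact (h t).trans_lt ENNReal.ofReal_lt_top
  refine ⟨hint, fun t => ?_⟩
  rw [Real.coe_toNNReal _ hc, mgf, ← ENNReal.ofReal_le_ofReal_iff (Real.exp_pos _).le,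
    ofReal_integral_eq_lintegral_ofReal (hint t) (ae_of_all _ fun ω => (Real.exp_pos _).le)]
  exact h t

lemma lintegral_exp_le_of_hasSubgaussianMGF {Ω : Type*} [MeasurableSpace Ω] {P : Measure Ω}
    {X : Ω → ℝ} {c : NNReal} (h : HasSubgaussianMGF X c P) (t : ℝ) :
    ∫⁻ ω, ENNReal.ofReal (Real.exp (t * X ω)) ∂P ≤ ENNReal.ofReal (Real.exp (c * t ^ 2 / 2)) := by
  rw [← ofReal_integral_eq_lintegral_ofReal (h.integrable_exp_mul t)
    (ae_of_all _ fun ω => (Real.exp_pos _).le)]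
  exact ENNReal.ofReal_le_ofReal (h.mgf_le t)

lemma SubGaussianLE.lintegral_exp_le {Z : Type*} [MeasurableSpace Z] {f : Z → ℝ} {η : ℝ}
    {q : Measure Z} (h : SubGaussianLE f η q) (a : ℝ) :
    ∫⁻ z, ENNReal.ofReal (Real.exp (a * f z)) ∂q
      ≤ ENNReal.ofReal (Real.exp (a * ∫ z, f z ∂q + η ^ 2 * a ^ 2 / 2)) := by
  have h1 := lintegral_exp_le_of_hasSubgaussianMGF h.2 a
  rw [Real.coe_toNNReal _ (sq_nonneg η)] at h1
  calc ∫⁻ z, ENNReal.ofReal (Real.exp (a * f z)) ∂q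
      = ∫⁻ z, ENNReal.ofReal (Real.exp (a * ∫ z, f z ∂q))
          * ENNReal.ofReal (Real.exp (a * (f z - ∫ z', f z' ∂q))) ∂q := by
        refine lintegral_congr fun z => ?_
        rw [← ENNReal.ofReal_mul (Real.exp_pos _).le, ← Real.exp_add]
        congr 2
        ring
    _ ≤ _ := by
        rw [lintegral_const_mul' _ _ ENNReal.ofReal_ne_top, Real.exp_add,
          ENNReal.ofReal_mul (Real.exp_pos _).le]
        gcongr

/-- Two-sided Chernoff bound. The variable vanishes almost surely when the parameter is `0`. -/
lemma measure_abs_gt_le {Ω : Type*} [MeasurableSpace Ω] {P : Measure Ω} [IsProbabilityMeasure P]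
    {X : Ω → ℝ} {η : ℝ} (h : HasSubgaussianMGF X (η ^ 2).toNNReal P) (hη : 0 ≤ η) {L : ℝ}
    (hL : 0 ≤ L) :
    P {ω | η * √(2 * L) < |X ω|} ≤ ENNReal.ofReal (2 * Real.exp (-L)) := by
  rcases hη.eq_or_lt with rfl | hpos
  · have h0 : X =ᵐ[P] 0 := by
      have : ((0 : ℝ) ^ 2).toNNReal = 0 := by simp
      rw [this] at h
      exact h.ae_eq_zero_of_hasSubgaussianMGF_zero
    have : P {ω | 0 * √(2 * L) < |X ω|} = 0 := by
      refine measure_mono_null (fun ω hω => ?_) (ae_iff.1 h0)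
      simpa using hω
    rw [this]
    exact zero_le
  have tail : ∀ Y : Ω → ℝ, HasSubgaussianMGF Y (η ^ 2).toNNReal P →
      P {ω | η * √(2 * L) ≤ Y ω} ≤ ENNReal.ofReal (Real.exp (-L)) := by
    intro Y hY
    have h1 := hY.measure_ge_le (ε := η * √(2 * L)) (by positivity)
    rw [Real.coe_toNNReal _ (sq_nonneg η)] at h1
    have h2 : -(η * √(2 * L)) ^ 2 / (2 * η ^ 2) = -L := by
      rw [mul_pow, Real.sq_sqrt (by positivity)]
      field_simp
    rw [h2] at h1
    rw [← ofReal_measureReal]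
    exact ENNReal.ofReal_le_ofReal h1
  calc P {ω | η * √(2 * L) < |X ω|}
      ≤ P ({ω | η * √(2 * L) ≤ X ω} ∪ {ω | η * √(2 * L) ≤ (-X) ω}) := by
        refine measure_mono fun ω hω => ?_
        rcases lt_abs.1 (show η * √(2 * L) < |X ω| from hω) with h | h
        · exact Or.inl h.le
        · exact Or.inr h.le
    _ ≤ ENNReal.ofReal (Real.exp (-L)) + ENNReal.ofReal (Real.exp (-L)) :=
        (measure_union_le _ _).trans (add_le_add (tail _ h) (tail _ h.neg))
    _ = ENNReal.ofReal (2 * Real.exp (-L)) := by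
        rw [← ENNReal.ofReal_add (Real.exp_pos _).le (Real.exp_pos _).le, two_mul]

/-! ### Linear combinations of sampling errors and changes -/

lemma measurable_integral_random {Ω Z : Type*} {mΩ : MeasurableSpace Ω} [MeasurableSpace Z]
    {f : Z → ℝ} (hf : Measurable f) {q : Ω → Measure Z} (hq : Measurable q) :
    Measurable fun ω => ∫ z, f z ∂(q ω) :=
  (StronglyMeasurable.integral_kernel (κ := (⟨q, hq⟩ : Kernel Ω Z))
    hf.stronglyMeasurable).measurable

section EvolvingTasks

variable {Ω Z : Type*} [MeasurableSpace Ω] [MeasurableSpace Z] {P : Measure Ω}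
  [IsProbabilityMeasure P] {k : ℕ} {n : ℕ → ℕ} {p : ℕ → Ω → Measure Z} {D : ℕ → ℕ → Ω → Z}
  {f : Z → ℝ} {M κ : ℝ} {σ d : ℕ → ℝ}

/-- A linear combination of the independent and centered changes of the expectation of `f` is
sub-Gaussian, and the variance proxies add up. -/
lemma EvolvingTasks.hasSubgaussianMGF_changes (ht : EvolvingTasks P k n p D) (hf : Measurable f)
    (hM : ∀ z, |f z| ≤ M)
    (hκd : ∀ j ∈ Finset.Icc 2 k,
      SubGaussianLE (fun ω => ∫ z, f z ∂(p j ω) - ∫ z, f z ∂(p (j - 1) ω)) (κ * d j) P)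
    (β : ℕ → ℝ) :
    HasSubgaussianMGF
      (fun ω => ∑ j ∈ Finset.Icc 2 k, β j * (∫ z, f z ∂(p j ω) - ∫ z, f z ∂(p (j - 1) ω)))
      (κ ^ 2 * ∑ j ∈ Finset.Icc 2 k, β j ^ 2 * d j ^ 2).toNNReal P := by
  have hmem : ∀ j ∈ Finset.Icc 2 k, j ∈ Finset.Icc 1 k ∧ j - 1 ∈ Finset.Icc 1 k := by
    intro j hj
    simp only [Finset.mem_Icc] at hj ⊢
    omega
  have hind : iIndepFun (fun (j : Finset.Icc 2 k) (ω : Ω) =>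
      β j * (∫ z, f z ∂(p j ω) - ∫ z, f z ∂(p (j - 1) ω))) P := by
    have h : iIndepFun (fun (j : Finset.Icc 2 k) (ω : Ω) =>
        ∫ z, f z ∂(p j ω) - ∫ z, f z ∂(p (j - 1) ω)) P := by
      rw [iIndepFun_iff_iIndep]
      refine iIndep_of_iIndep_of_le ht.independent_changes.iIndep fun j => ?_
      exact (measurable_integral_sub hf hM (ht.isProbabilityMeasure j (hmem j j.2).1)
        (ht.isProbabilityMeasure (j - 1) (hmem j j.2).2)).comap_le
    exact h.comp (fun j x => β j * x) fun j => measurable_const_mul _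
  have hsub : ∀ j ∈ (Finset.univ : Finset (Finset.Icc 2 k)), HasSubgaussianMGF (fun ω =>
      β j * (∫ z, f z ∂(p j ω) - ∫ z, f z ∂(p (j - 1) ω)))
      (κ ^ 2 * (β j ^ 2 * d j ^ 2)).toNNReal P := by
    intro j _
    have h := (hκd j j.2).2
    have hj := hmem j j.2
    simp only [integral_integral_sub_eq_zero hf hM (ht.measurable_distribution j hj.1)
      (ht.measurable_distribution _ hj.2) (ht.isProbabilityMeasure j hj.1)
      (ht.isProbabilityMeasure _ hj.2) (ht.zero_mean_changes j j.2), sub_zero] at h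
    convert h.const_mul (β j) using 1
    refine NNReal.eq ?_
    change _ = β j ^ 2 * (((κ * d j) ^ 2).toNNReal : ℝ)
    rw [Real.coe_toNNReal _ (by positivity), Real.coe_toNNReal _ (by positivity)]
    ring
  have hsum := HasSubgaussianMGF.sum_of_iIndepFun hind hsub
  convert hsum using 1
  · funext ω
    exact (Finset.sum_coe_sort (Finset.Icc 2 k) fun j =>
      β j * (∫ z, f z ∂(p j ω) - ∫ z, f z ∂(p (j - 1) ω))).symm
  · rw [Finset.mul_sum, Real.toNNReal_sum_of_nonneg fun j _ => by positivity,
      Finset.sum_coe_sort (Finset.Icc 2 k) fun j => (κ ^ 2 * (β j ^ 2 * d j ^ 2)).toNNReal]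

/-- The σ-algebra generated by the random distributions of the tasks `1, …, k`. -/
@[reducible] def distributionAlgebra (p : ℕ → Ω → Measure Z) (k : ℕ) : MeasurableSpace Ω :=
  ⨆ j ∈ Finset.Icc 1 k, MeasurableSpace.comap (p j) Measure.instMeasurableSpace

/-- A linear combination of the errors of the sample averages of `f` and of the changes of its
expectation is sub-Gaussian. The samples are integrated out first, given the distributions of
the tasks. -/
theorem EvolvingTasks.hasSubgaussianMGF (ht : EvolvingTasks P k n p D)
    (hn : ∀ j ∈ Finset.Icc 1 k, 0 < n j) (hf : Measurable f) (hM : ∀ z, |f z| ≤ M)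
    (hκσ : ∀ j ∈ Finset.Icc 1 k, ∀ᵐ ω ∂P, SubGaussianLE f (κ * σ j) (p j ω))
    (hκd : ∀ j ∈ Finset.Icc 2 k,
      SubGaussianLE (fun ω => ∫ z, f z ∂(p j ω) - ∫ z, f z ∂(p (j - 1) ω)) (κ * d j) P)
    (α β : ℕ → ℝ) :
    HasSubgaussianMGF
      (fun ω => ∑ j ∈ Finset.Icc 1 k, α j *
          (1 / (n j : ℝ) * ∑ l ∈ Finset.range (n j), f (D j l ω) - ∫ z, f z ∂(p j ω))
        + ∑ j ∈ Finset.Icc 2 k, β j * (∫ z, f z ∂(p j ω) - ∫ z, f z ∂(p (j - 1) ω)))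
      (κ ^ 2 * (∑ j ∈ Finset.Icc 1 k, α j ^ 2 * (σ j ^ 2 / n j)
        + ∑ j ∈ Finset.Icc 2 k, β j ^ 2 * d j ^ 2)).toNNReal P := by
  have h𝓖 : distributionAlgebra p k ≤ ‹MeasurableSpace Ω› :=
    iSup₂_le fun j hj => (ht.measurable_distribution j hj).comap_le
  have hp𝓖 : ∀ j ∈ Finset.Icc 1 k, Measurable[distributionAlgebra p k] (p j) := fun j hj =>
    Measurable.of_comap_le (le_iSup₂ (f := fun j (_ : j ∈ Finset.Icc 1 k) =>
      MeasurableSpace.comap (p j) Measure.instMeasurableSpace) j hj)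
  have hI𝓖 : ∀ j ∈ Finset.Icc 1 k, Measurable[distributionAlgebra p k] fun ω => ∫ z, f z ∂(p j ω) :=
    fun j hj => measurable_integral_random hf (hp𝓖 j hj)
  have hmem : ∀ j ∈ Finset.Icc 2 k, j ∈ Finset.Icc 1 k ∧ j - 1 ∈ Finset.Icc 1 k := by
    intro j hj
    simp only [Finset.mem_Icc] at hj ⊢
    omega
  have hW𝓖 : Measurable[distributionAlgebra p k] fun ω =>
      ∑ j ∈ Finset.Icc 2 k, β j * (∫ z, f z ∂(p j ω) - ∫ z, f z ∂(p (j - 1) ω)) :=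
    Finset.measurable_sum _ fun j hj =>
      ((hI𝓖 j (hmem j hj).1).sub (hI𝓖 _ (hmem j hj).2)).const_mul _
  set W : Ω → ℝ := fun ω =>
    ∑ j ∈ Finset.Icc 2 k, β j * (∫ z, f z ∂(p j ω) - ∫ z, f z ∂(p (j - 1) ω)) with hW
  have hX : Measurable fun ω => ∑ j ∈ Finset.Icc 1 k, α j *
      (1 / (n j : ℝ) * ∑ l ∈ Finset.range (n j), f (D j l ω) - ∫ z, f z ∂(p j ω)) + W ω := by
    refine Measurable.add (Finset.measurable_sum _ fun j hj => Measurable.const_mul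
      (Measurable.sub (Measurable.const_mul (Finset.measurable_sum _ fun l hl => ?_) _) ?_) _) ?_
    · exact hf.comp (ht.measurable_sample j hj l (Finset.mem_range.1 hl))
    · exact (hI𝓖 j hj).mono h𝓖 le_rfl
    · exact hW𝓖.mono h𝓖 le_rfl
  refine hasSubgaussianMGF_of_lintegral_le hX.aemeasurable (by positivity) fun t => ?_
  set S : Finset (Σ _ : ℕ, ℕ) := (Finset.Icc 1 k).sigma fun j => Finset.range (n j) with hS
  have hSmem : ∀ x ∈ S, x.1 ∈ Finset.Icc 1 k ∧ x.2 < n x.1 := fun x hx => by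
    simpa [hS] using hx
  set a : ℕ → ℝ := fun j => t * α j / n j with ha
  have hsumS : ∀ c : ℕ → ℝ, ∑ x ∈ S, c x.1 = ∑ j ∈ Finset.Icc 1 k, n j * c j := fun c => by
    rw [hS, Finset.sum_sigma]
    simp
  set F : Ω → ENNReal := fun ω => ENNReal.ofReal
    (Real.exp (t * W ω - ∑ x ∈ S, a x.1 * ∫ z, f z ∂(p x.1 ω))) with hF
  have hF𝓖 : Measurable[distributionAlgebra p k] F := by
    refine ENNReal.measurable_ofReal.comp (Real.measurable_exp.comp
      ((hW𝓖.const_mul t).sub (Finset.measurable_sum _ fun x hx => ?_)))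
    exact (hI𝓖 x.1 (hSmem x hx).1).const_mul _
  have hprodexp : ∀ c : (Σ _ : ℕ, ℕ) → ℝ, ∏ x ∈ S, ENNReal.ofReal (Real.exp (c x))
      = ENNReal.ofReal (Real.exp (∑ x ∈ S, c x)) := fun c => by
    rw [Real.exp_sum, ENNReal.ofReal_prod_of_nonneg fun _ _ => (Real.exp_pos _).le]
  -- the exponential factorizes into a function of the task distributions and one per sample
  have hfactor : ∀ ω, ENNReal.ofReal (Real.exp (t * (∑ j ∈ Finset.Icc 1 k, α j *
      (1 / (n j : ℝ) * ∑ l ∈ Finset.range (n j), f (D j l ω) - ∫ z, f z ∂(p j ω)) + W ω)))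
      = F ω * ∏ x ∈ S, ENNReal.ofReal (Real.exp (a x.1 * f (D x.1 x.2 ω))) := by
    intro ω
    rw [hprodexp, hF, ← ENNReal.ofReal_mul (Real.exp_pos _).le, ← Real.exp_add]
    congr 2
    rw [hsumS fun j => a j * ∫ z, f z ∂(p j ω)]
    rw [hS, Finset.sum_sigma]
    simp only [← Finset.mul_sum]
    have : ∑ j ∈ Finset.Icc 1 k, α j *
        (1 / (n j : ℝ) * ∑ l ∈ Finset.range (n j), f (D j l ω) - ∫ z, f z ∂(p j ω)) * t
        = ∑ j ∈ Finset.Icc 1 k, a j * ∑ l ∈ Finset.range (n j), f (D j l ω)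
          - ∑ j ∈ Finset.Icc 1 k, n j * (a j * ∫ z, f z ∂(p j ω)) := by
      rw [← Finset.sum_sub_distrib]
      refine Finset.sum_congr rfl fun j hj => ?_
      have : (n j : ℝ) ≠ 0 := by exact_mod_cast (hn j hj).ne'
      simp only [ha]
      field_simp
    rw [← Finset.sum_mul] at this
    linarith
  have hlaw := lintegral_mul_prod_eq (P := P) h𝓖 S (p := fun x => p x.1)
    (fun x hx => hp𝓖 _ (hSmem x hx).1) (D := fun x => D x.1 x.2)
    (fun x hx => ht.measurable_sample _ (hSmem x hx).1 _ (hSmem x hx).2)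
    (fun G hG A hA => by
      have := ht.sample_law G hG (fun j i => A ⟨j, i⟩) fun j i => hA _
      rw [hS]
      simp only [Finset.prod_sigma]
      rw [← this]
      congr 2
      ext ω
      simp only [Set.mem_iInter, Finset.mem_sigma]
      exact ⟨fun h j hj i hi => h ⟨j, i⟩ ⟨hj, hi⟩, fun h x hx => h x.1 hx.1 x.2 hx.2⟩)
    hF𝓖 (g := fun x z => ENNReal.ofReal (Real.exp (a x.1 * f z)))
    (fun x => ENNReal.measurable_ofReal.comp (Real.measurable_exp.comp (hf.const_mul _)))
  have hae : ∀ᵐ ω ∂P, ∀ x ∈ S, SubGaussianLE f (κ * σ x.1) (p x.1 ω) :=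
    (ae_ball_iff S.countable_toSet).2 fun x hx => hκσ x.1 (hSmem x hx).1
  have hchanges := lintegral_exp_le_of_hasSubgaussianMGF
    (ht.hasSubgaussianMGF_changes hf hM hκd β) t
  calc ∫⁻ ω, ENNReal.ofReal (Real.exp (t * (∑ j ∈ Finset.Icc 1 k, α j *
        (1 / (n j : ℝ) * ∑ l ∈ Finset.range (n j), f (D j l ω) - ∫ z, f z ∂(p j ω)) + W ω))) ∂P
      = ∫⁻ ω, F ω * ∏ x ∈ S, ∫⁻ z, ENNReal.ofReal (Real.exp (a x.1 * f z)) ∂(p x.1 ω) ∂P := by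
        rw [← hlaw]
        exact lintegral_congr hfactor
    _ ≤ ∫⁻ ω, ENNReal.ofReal (Real.exp (∑ x ∈ S, (κ * σ x.1) ^ 2 * a x.1 ^ 2 / 2))
          * ENNReal.ofReal (Real.exp (t * W ω)) ∂P := by
        refine lintegral_mono_ae ?_
        filter_upwards [hae] with ω hω
        calc F ω * ∏ x ∈ S, ∫⁻ z, ENNReal.ofReal (Real.exp (a x.1 * f z)) ∂(p x.1 ω)
            ≤ F ω * ∏ x ∈ S, ENNReal.ofReal (Real.exp (a x.1 * ∫ z, f z ∂(p x.1 ω)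
                + (κ * σ x.1) ^ 2 * a x.1 ^ 2 / 2)) :=
              mul_le_mul_right (Finset.prod_le_prod' fun x hx => (hω x hx).lintegral_exp_le _) _
          _ = _ := by
              rw [hprodexp, hF, ← ENNReal.ofReal_mul (Real.exp_pos _).le,
                ← ENNReal.ofReal_mul (Real.exp_pos _).le, ← Real.exp_add, ← Real.exp_add,
                Finset.sum_add_distrib]
              congr 2
              ring
    _ ≤ ENNReal.ofReal (Real.exp (∑ x ∈ S, (κ * σ x.1) ^ 2 * a x.1 ^ 2 / 2))
          * ENNReal.ofReal (Real.exp
            ((κ ^ 2 * ∑ j ∈ Finset.Icc 2 k, β j ^ 2 * d j ^ 2).toNNReal * t ^ 2 / 2)) := by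
        rw [lintegral_const_mul' _ _ ENNReal.ofReal_ne_top]
        gcongr
    _ = _ := by
        rw [← ENNReal.ofReal_mul (Real.exp_pos _).le, ← Real.exp_add,
          Real.coe_toNNReal _ (by positivity)]
        congr 2
        rw [hsumS fun j => (κ * σ j) ^ 2 * a j ^ 2 / 2, mul_add, add_mul, add_div]
        congr 1
        rw [Finset.mul_sum, Finset.sum_mul, Finset.sum_div]
        refine Finset.sum_congr rfl fun j hj => ?_
        have : (n j : ℝ) ≠ 0 := by exact_mod_cast (hn j hj).ne'
        simp only [ha]
        field_simp

end EvolvingTasks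

/-! ### Estimation errors of forward and backward learning -/

section Recursions

variable {m : ℕ}

/-- For the component `i`, the estimate `est` of the mean vector of task `j` has an error that is a
linear combination, with deterministic coefficients, of the sampling errors of the tasks in `S` and
of the changes `θ b - θ (b - 1)` for `b ∈ T`; and `v` is the variance of that combination for
uncorrelated errors and changes with variances `s` and `d ^ 2`. -/
def IsLinearEstimate (s d : ℕ → Fin m → ℝ) (i : Fin m) (S T : Finset ℕ)
    (est : (ℕ → Fin m → ℝ) → Fin m → ℝ) (j : ℕ) (v : ℝ) : Prop :=
  ∃ α β : ℕ → ℝ, (∀ a ∉ S, α a = 0) ∧ (∀ b ∉ T, β b = 0) ∧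
    (∀ τ θ : ℕ → Fin m → ℝ, est τ i - θ j i
      = ∑ a ∈ S, α a * (τ a i - θ a i) + ∑ b ∈ T, β b * (θ b i - θ (b - 1) i)) ∧
    ∑ a ∈ S, α a ^ 2 * s a i + ∑ b ∈ T, β b ^ 2 * d b i ^ 2 = v

variable {s d : ℕ → Fin m → ℝ} {i : Fin m} {S T S' T' : Finset ℕ}
  {est est' : (ℕ → Fin m → ℝ) → Fin m → ℝ} {j : ℕ} {v v' : ℝ}

lemma isLinearEstimate_single (s d : ℕ → Fin m → ℝ) (i : Fin m) (j : ℕ) :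
    IsLinearEstimate s d i {j} ∅ (fun τ => τ j) j (s j i) :=
  ⟨fun a => if a = j then 1 else 0, 0, fun a ha => by simpa using ha, fun _ _ => rfl,
    fun τ θ => by simp, by simp⟩

lemma IsLinearEstimate.mono (h : IsLinearEstimate s d i S T est j v) (hS : S ⊆ S') (hT : T ⊆ T') :
    IsLinearEstimate s d i S' T' est j v := by
  obtain ⟨α, β, hα, hβ, hest, hv⟩ := h
  refine ⟨α, β, fun a ha => hα a fun h => ha (hS h), fun b hb => hβ b fun h => hb (hT h),
    fun τ θ => ?_, ?_⟩
  · rw [hest, Finset.sum_subset hS fun a _ ha => by simp [hα a ha],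
      Finset.sum_subset hT fun b _ hb => by simp [hβ b hb]]
  · rw [← hv, Finset.sum_subset hS fun a _ ha => by simp [hα a ha],
      Finset.sum_subset hT fun b _ hb => by simp [hβ b hb]]

/-- An estimate for a task serves as an estimate for an adjacent task, with the additional variance
of the change between the two. -/
lemma IsLinearEstimate.shift (h : IsLinearEstimate s d i S T est j v) {b j' : ℕ} (hb : b ∉ T)
    {c : ℝ} (hc : c ^ 2 = 1)
    (hθ : ∀ θ : ℕ → Fin m → ℝ, θ j i - θ j' i = c * (θ b i - θ (b - 1) i)) :
    IsLinearEstimate s d i S (insert b T) est j' (v + d b i ^ 2) := by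
  classical
  obtain ⟨α, β, hα, hβ, hest, hv⟩ := h
  have e : ∀ φ : ℕ → ℝ → ℝ, ∑ a ∈ insert b T, φ a (Function.update β b c a)
      = φ b c + ∑ a ∈ T, φ a (β a) := by
    intro φ
    rw [Finset.sum_insert hb, Function.update_self]
    congr 1
    exact Finset.sum_congr rfl fun a ha => by
      rw [Function.update_of_ne (ne_of_mem_of_not_mem ha hb)]
  refine ⟨α, Function.update β b c, hα, fun a ha => ?_, fun τ θ => ?_, ?_⟩
  · rw [Finset.mem_insert, not_or] at ha
    rw [Function.update_of_ne ha.1, hβ a ha.2]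
  · rw [e fun a x => x * (θ a i - θ (a - 1) i)]
    linarith [hest τ θ, hθ θ]
  · rw [e fun a x => x ^ 2 * d a i ^ 2, hc, ← hv]
    ring

/-- An estimate for the task `j` serves as an estimate for the next task. -/
lemma IsLinearEstimate.shift_forward (h : IsLinearEstimate s d i S T est j v) (hT : j + 1 ∉ T) :
    IsLinearEstimate s d i S (insert (j + 1) T) est (j + 1) (v + d (j + 1) i ^ 2) :=
  h.shift hT (c := -1) (by norm_num) fun θ => by simp

/-- An estimate for a task serves as an estimate for the preceding task. -/
lemma IsLinearEstimate.shift_backward (h : IsLinearEstimate s d i S T est (j + 1) v)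
    (hT : j + 1 ∉ T) :
    IsLinearEstimate s d i S (insert (j + 1) T) est j (v + d (j + 1) i ^ 2) :=
  h.shift hT (c := 1) (by norm_num) fun θ => by simp

/-- Two estimates with unrelated errors are combined with weights inversely proportional to their
variances. -/
lemma IsLinearEstimate.combine (h : IsLinearEstimate s d i S T est j v)
    (h' : IsLinearEstimate s d i S' T' est' j v') (hS : Disjoint S S') (hT : Disjoint T T')
    (hv0 : 0 < v) (hv0' : 0 < v') {est'' : (ℕ → Fin m → ℝ) → Fin m → ℝ}
    (hest'' : ∀ τ, est'' τ i = est τ i + v / (v + v') * (est' τ i - est τ i)) :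
    IsLinearEstimate s d i (S ∪ S') (T ∪ T') est'' j (1 / v + 1 / v')⁻¹ := by
  obtain ⟨α, β, hα, hβ, hest, hv⟩ := h
  obtain ⟨α', β', hα', hβ', hest', hv'⟩ := h'
  have hne : v + v' ≠ 0 := by positivity
  set c := v / (v + v') with hc
  have split : ∀ {S S' : Finset ℕ} {α α' : ℕ → ℝ} (_ : Disjoint S S') (_ : ∀ a ∉ S, α a = 0)
      (_ : ∀ a ∉ S', α' a = 0) (φ : ℕ → ℝ → ℝ), ∑ a ∈ S ∪ S', φ a ((1 - c) * α a + c * α' a)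
        = ∑ a ∈ S, φ a ((1 - c) * α a) + ∑ a ∈ S', φ a (c * α' a) := by
    intro S S' α α' hS hα hα' φ
    rw [Finset.sum_union hS]
    congr 1
    · refine Finset.sum_congr rfl fun a ha => ?_
      rw [hα' a (Finset.disjoint_left.1 hS ha), mul_zero, add_zero]
    · refine Finset.sum_congr rfl fun a ha => ?_
      rw [hα a (Finset.disjoint_right.1 hS ha), mul_zero, zero_add]
  refine ⟨fun a => (1 - c) * α a + c * α' a, fun b => (1 - c) * β b + c * β' b,
    fun a ha => ?_, fun b hb => ?_, fun τ θ => ?_, ?_⟩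
  · rw [Finset.mem_union, not_or] at ha
    simp [hα a ha.1, hα' a ha.2]
  · rw [Finset.mem_union, not_or] at hb
    simp [hβ b hb.1, hβ' b hb.2]
  · rw [split hS hα hα' fun a x => x * (τ a i - θ a i),
      split hT hβ hβ' fun b x => x * (θ b i - θ (b - 1) i), hest'']
    simp only [mul_assoc, ← Finset.mul_sum]
    linear_combination (1 - c) * hest τ θ + c * hest' τ θ
  · rw [split hS hα hα' fun a x => x ^ 2 * s a i, split hT hβ hβ' fun b x => x ^ 2 * d b i ^ 2]
    simp only [mul_pow, mul_assoc, ← Finset.mul_sum]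
    have e : (1 / v + 1 / v')⁻¹ = (1 - c) ^ 2 * v + c ^ 2 * v' := by
      rw [hc]
      field_simp
      ring
    rw [e]
    linear_combination (1 - c) ^ 2 * hv + c ^ 2 * hv'

variable {k : ℕ}

lemma forwardMSE_pos (hs : ∀ j ∈ Finset.Icc 1 k, 0 < s j i) :
    ∀ j ∈ Finset.Icc 1 k, 0 < forwardMSE s d j i := by
  intro j hj
  induction j with
  | zero => simp at hj
  | succ j ih =>
    rcases j with _ | j
    · exact hs 1 hj
    · have h1 := ih (by simp at hj ⊢; omega)
      have h2 := hs _ hj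
      simp only [forwardMSE, Pi.inv_apply, Pi.add_apply, Pi.div_apply, Pi.one_apply, Pi.pow_apply]
      positivity

lemma backwardMSE_pos (hs : ∀ j ∈ Finset.Icc 1 k, 0 < s j i) :
    ∀ j ∈ Finset.Icc 1 k, 0 < backwardMSE s d k j i := by
  intro j hj
  obtain ⟨hj0, hjk⟩ := Finset.mem_Icc.1 hj
  clear hj
  induction hjk using Nat.decreasingInduction with
  | self =>
    have hj := Finset.mem_Icc.2 ⟨hj0, le_rfl⟩
    rw [backwardMSE, if_neg (lt_irrefl k)]
    exact hs k hj
  | of_succ j hjk ih =>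
    have hj : 1 ≤ j ∧ j ≤ k := ⟨hj0, hjk.le⟩
    have h1 := ih (by omega)
    have h2 := hs j (Finset.mem_Icc.2 hj)
    rw [backwardMSE, if_pos hjk]
    simp only [Pi.inv_apply, Pi.add_apply, Pi.div_apply, Pi.one_apply, Pi.pow_apply]
    positivity

lemma smoothMSE_pos (hs : ∀ j ∈ Finset.Icc 1 k, 0 < s j i) :
    ∀ j ∈ Finset.Icc 1 k, 0 < smoothMSE s d k j i := by
  intro j hj
  rw [Finset.mem_Icc] at hj
  rw [smoothMSE]
  split_ifs with h
  · have h1 := forwardMSE_pos (d := d) hs j (Finset.mem_Icc.2 hj)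
    have h2 := backwardMSE_pos (d := d) hs (j + 1) (Finset.mem_Icc.2 ⟨by omega, h⟩)
    simp only [Pi.inv_apply, Pi.add_apply, Pi.div_apply, Pi.one_apply, Pi.pow_apply]
    positivity
  · exact forwardMSE_pos hs k (Finset.mem_Icc.2 ⟨by omega, le_rfl⟩)

lemma isLinearEstimate_forwardMean (hs : ∀ j ∈ Finset.Icc 1 k, 0 < s j i) :
    ∀ j ∈ Finset.Icc 1 k, IsLinearEstimate s d i (Finset.Icc 1 j) (Finset.Icc 2 j)
      (fun τ => forwardMean τ s d j) j (forwardMSE s d j i) := by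
  intro j hj
  induction j with
  | zero => simp at hj
  | succ j ih =>
    rcases j with _ | j
    · exact isLinearEstimate_single s d i 1
    · have hj' : j + 1 ∈ Finset.Icc 1 k := by simp at hj ⊢; omega
      have h := (ih hj').shift_forward (by simp)
      have hpos := forwardMSE_pos (d := d) hs _ hj'
      have key := (isLinearEstimate_single s d i (j + 2)).combine h (by simp) (by simp) (hs _ hj)
        (by positivity) (est'' := fun τ => forwardMean τ s d (j + 2)) (fun τ => by
          simp only [forwardMean, Pi.add_apply, Pi.mul_apply, Pi.div_apply, Pi.pow_apply,
            Pi.sub_apply]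
          congr 3
          ring)
      refine key.mono (fun a ha => ?_) fun b hb => ?_
      · simp at ha ⊢; omega
      · simp at hb ⊢; omega

lemma isLinearEstimate_backwardMean (hs : ∀ j ∈ Finset.Icc 1 k, 0 < s j i) :
    ∀ j ∈ Finset.Icc 1 k, IsLinearEstimate s d i (Finset.Icc j k) (Finset.Icc (j + 1) k)
      (fun τ => backwardMean τ s d k j) j (backwardMSE s d k j i) := by
  intro j hj
  obtain ⟨hj0, hjk⟩ := Finset.mem_Icc.1 hj
  clear hj
  induction hjk using Nat.decreasingInduction with
  | self =>
    have hj := Finset.mem_Icc.2 ⟨hj0, le_rfl⟩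
    have e1 : (fun τ => backwardMean τ s d k k) = fun τ => τ k := by
      funext τ; rw [backwardMean, if_neg (lt_irrefl k)]
    have e2 : backwardMSE s d k k i = s k i := by rw [backwardMSE, if_neg (lt_irrefl k)]
    rw [e1, e2]
    exact (isLinearEstimate_single s d i k).mono (by simp) (by simp)
  | of_succ j hjk ih =>
    have hj : 1 ≤ j ∧ j ≤ k := ⟨hj0, hjk.le⟩
    have hj1 : 1 ≤ j + 1 ∧ j + 1 ≤ k := ⟨by omega, hjk⟩
    have h := (ih hj1.1).shift_backward (by simp)
    have hpos := backwardMSE_pos (d := d) hs _ (Finset.mem_Icc.2 hj1)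
    have key := (isLinearEstimate_single s d i j).combine h (by simp) (by simp)
      (hs _ (Finset.mem_Icc.2 hj)) (by positivity)
      (est'' := fun τ => backwardMean τ s d k j) (fun τ => by
        rw [backwardMean, if_pos hjk]
        simp only [Pi.add_apply, Pi.mul_apply, Pi.div_apply, Pi.pow_apply, Pi.sub_apply]
        congr 3
        ring)
    have e : backwardMSE s d k j i
        = (1 / s j i + 1 / (backwardMSE s d k (j + 1) i + d (j + 1) i ^ 2))⁻¹ := by
      rw [backwardMSE, if_pos hjk]; rfl
    rw [e]
    refine key.mono (fun a ha => ?_) fun b hb => ?_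
    · simp at ha ⊢; omega
    · simp at hb ⊢; omega

lemma isLinearEstimate_smoothMean (hs : ∀ j ∈ Finset.Icc 1 k, 0 < s j i) :
    ∀ j ∈ Finset.Icc 1 k, IsLinearEstimate s d i (Finset.Icc 1 k) (Finset.Icc 2 k)
      (fun τ => smoothMean τ s d k j) j (smoothMSE s d k j i) := by
  intro j hj
  have hj' := Finset.mem_Icc.1 hj
  by_cases hjk : j < k
  · have hj1 : j + 1 ∈ Finset.Icc 1 k := Finset.mem_Icc.2 ⟨by omega, hjk⟩
    have h := (isLinearEstimate_backwardMean (d := d) hs _ hj1).shift_backward (by simp)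
    have hpos := backwardMSE_pos (d := d) hs _ hj1
    have key := (isLinearEstimate_forwardMean (d := d) hs j hj).combine h
      (Finset.disjoint_left.2 fun a ha hb => by simp at ha hb; omega)
      (Finset.disjoint_left.2 fun a ha hb => by simp at ha hb; omega)
      (forwardMSE_pos hs j hj) (by positivity)
      (est'' := fun τ => smoothMean τ s d k j) (fun τ => by
        rw [smoothMean, if_pos hjk]
        simp only [Pi.add_apply, Pi.mul_apply, Pi.div_apply, Pi.pow_apply, Pi.sub_apply]
        congr 3
        ring)
    have e : smoothMSE s d k j i
        = (1 / forwardMSE s d j i + 1 / (backwardMSE s d k (j + 1) i + d (j + 1) i ^ 2))⁻¹ := by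
      rw [smoothMSE, if_pos hjk]; rfl
    rw [e]
    refine key.mono (fun a ha => ?_) fun b hb => ?_
    · simp at ha ⊢; omega
    · simp at hb ⊢; omega
  · obtain rfl : j = k := by omega
    have h := isLinearEstimate_forwardMean (d := d) hs j hj
    simpa only [smoothMean, smoothMSE, lt_irrefl, if_false] using h

end Recursions

/-! ### Effective sample sizes -/

section Sizes

/-- The effective sample size of a task that has `N` samples of its own and an adjacent task with
effective sample size `N'`. -/
noncomputable def pooledSize (N N' A B : ℝ) : ℝ := N + N' * (A / (A + N' * B))

lemma pooledSize_pos {N N' A B : ℝ} (hN : 0 < N) (hN' : 0 < N') (hA : 0 ≤ A) (hB : 0 ≤ B) :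
    0 < pooledSize N N' A B := by
  rw [pooledSize]; positivity

/-- One step of any of the recursions: if the MSEs `v` and `v'` are at most `M ^ 2 / N` and
`M ^ 2 / N'`, the MSE of their combination is bounded accordingly by the pooled size. The maximal
variance `A` may replace `M ^ 2` because `A / (A + N' * B)` is increasing in `A`. -/
lemma combinedMSE_le {N N' A B M v v' e : ℝ} (hN : 0 < N) (hN' : 0 < N') (hA : 0 < A)
    (hAM : A ≤ M ^ 2) (he : 0 ≤ e) (heB : e ≤ B) (hv : 0 < v) (hv' : 0 < v')
    (hvN : v ≤ M ^ 2 / N) (hvN' : v' ≤ M ^ 2 / N') :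
    (1 / v + 1 / (v' + e))⁻¹ ≤ M ^ 2 / pooledSize N N' A B := by
  have hM : 0 < M ^ 2 := hA.trans_le hAM
  have hB : 0 ≤ B := he.trans heB
  have h1 : N / M ^ 2 ≤ 1 / v := by
    rw [le_div_iff₀ hN] at hvN
    rw [div_le_div_iff₀ hM hv]
    linarith
  have h2 : N' * (A / (A + N' * B)) / M ^ 2 ≤ 1 / (v' + e) := by
    have h3 : v' + e ≤ M ^ 2 / N' + B := add_le_add hvN' heB
    refine le_trans ?_ (one_div_le_one_div_of_le (by positivity) h3)
    have h4 : 1 / (M ^ 2 / N' + B) = N' / (M ^ 2 + N' * B) := by field_simp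
    rw [h4, mul_div_assoc', div_div, div_le_div_iff₀ (by positivity) (by positivity)]
    have h5 : A * (N' * B) ≤ M ^ 2 * (N' * B) := mul_le_mul_of_nonneg_right hAM (by positivity)
    nlinarith [mul_le_mul_of_nonneg_left h5 hN'.le]
  have hpos : 0 < pooledSize N N' A B := pooledSize_pos hN hN' hA.le hB
  have hinv : pooledSize N N' A B / M ^ 2 ≤ 1 / v + 1 / (v' + e) := by
    rw [pooledSize, add_div]
    exact add_le_add h1 h2
  simpa using inv_anti₀ (div_pos hpos hM) hinv

/-- Effective sample sizes of forward learning, for tasks with `n j` samples, where `A j` and `B j`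
are the maximal squares of the standard deviations and of the changes. -/
noncomputable def forwardSize (n : ℕ → ℕ) (A B : ℕ → ℝ) : ℕ → ℝ
  | 0 => n 0
  | 1 => n 1
  | j + 2 => pooledSize (n (j + 2)) (forwardSize n A B (j + 1)) (A (j + 2)) (B (j + 2))

/-- Effective sample sizes of backward learning from the tasks `j, …, k`. -/
noncomputable def backwardSize (n : ℕ → ℕ) (A B : ℕ → ℝ) (k j : ℕ) : ℝ :=
  if j < k then pooledSize (n j) (backwardSize n A B k (j + 1)) (A j) (B (j + 1)) else n k
termination_by k - j

/-- Effective sample sizes of forward and backward learning. -/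
noncomputable def smoothSize (n : ℕ → ℕ) (A B : ℕ → ℝ) (k j : ℕ) : ℝ :=
  if j < k then pooledSize (forwardSize n A B j) (backwardSize n A B k (j + 1)) (A j) (B (j + 1))
  else forwardSize n A B k

variable {n : ℕ → ℕ} {A B : ℕ → ℝ} {k : ℕ}

lemma forwardSize_pos (hn : ∀ j ∈ Finset.Icc 1 k, 0 < n j) (hA : ∀ j, 0 ≤ A j)
    (hB : ∀ j, 0 ≤ B j) : ∀ j ∈ Finset.Icc 1 k, 0 < forwardSize n A B j := by
  intro j hj
  induction j with
  | zero => simp at hj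
  | succ j ih =>
    rcases j with _ | j
    · exact Nat.cast_pos.2 (hn 1 hj)
    · exact pooledSize_pos (Nat.cast_pos.2 (hn _ hj)) (ih (by simp at hj ⊢; omega)) (hA _) (hB _)

lemma backwardSize_pos (hn : ∀ j ∈ Finset.Icc 1 k, 0 < n j) (hA : ∀ j, 0 ≤ A j)
    (hB : ∀ j, 0 ≤ B j) : ∀ j ∈ Finset.Icc 1 k, 0 < backwardSize n A B k j := by
  intro j hj
  obtain ⟨hj0, hjk⟩ := Finset.mem_Icc.1 hj
  clear hj
  induction hjk using Nat.decreasingInduction with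
  | self =>
    have hj := Finset.mem_Icc.2 ⟨hj0, le_rfl⟩
    rw [backwardSize, if_neg (lt_irrefl k)]
    exact Nat.cast_pos.2 (hn k hj)
  | of_succ j hjk ih =>
    have hj : 1 ≤ j ∧ j ≤ k := ⟨hj0, hjk.le⟩
    rw [backwardSize, if_pos hjk]
    exact pooledSize_pos (Nat.cast_pos.2 (hn j (Finset.mem_Icc.2 hj))) (ih (by omega))
      (hA _) (hB _)

variable {m : ℕ} {σ d : ℕ → Fin m → ℝ} {M : ℝ} {i : Fin m}

lemma sq_apply_le_norm (x : Fin m → ℝ) (i : Fin m) : x i ^ 2 ≤ ‖x ^ 2‖ := by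
  have := norm_le_pi_norm (x ^ 2) i
  rwa [Pi.pow_apply, Real.norm_of_nonneg (sq_nonneg _)] at this

lemma norm_sq_le {x : Fin m → ℝ} (h : ∀ i, 0 < x i ∧ x i ≤ M) : ‖x ^ 2‖ ≤ M ^ 2 := by
  refine (pi_norm_le_iff_of_nonneg (sq_nonneg M)).2 fun i => ?_
  rw [Pi.pow_apply, Real.norm_of_nonneg (sq_nonneg _)]
  exact pow_le_pow_left₀ (h i).1.le (h i).2 2

lemma singleMSE_pos (hn : ∀ j ∈ Finset.Icc 1 k, 0 < n j)
    (hσ : ∀ j ∈ Finset.Icc 1 k, ∀ i, 0 < σ j i ∧ σ j i ≤ M) :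
    ∀ j ∈ Finset.Icc 1 k, 0 < singleMSE σ n j i := fun j hj =>
  div_pos (pow_pos (hσ j hj i).1 2) (Nat.cast_pos.2 (hn j hj))

lemma singleMSE_le (hσ : ∀ j ∈ Finset.Icc 1 k, ∀ i, 0 < σ j i ∧ σ j i ≤ M) :
    ∀ j ∈ Finset.Icc 1 k, singleMSE σ n j i ≤ M ^ 2 / n j := fun j hj =>
  div_le_div_of_nonneg_right (pow_le_pow_left₀ (hσ j hj i).1.le (hσ j hj i).2 2) (Nat.cast_nonneg _)

lemma forwardMSE_le (hn : ∀ j ∈ Finset.Icc 1 k, 0 < n j)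
    (hσ : ∀ j ∈ Finset.Icc 1 k, ∀ i, 0 < σ j i ∧ σ j i ≤ M) :
    ∀ j ∈ Finset.Icc 1 k, forwardMSE (singleMSE σ n) d j i
      ≤ M ^ 2 / forwardSize n (fun j => ‖σ j ^ 2‖) (fun j => ‖d j ^ 2‖) j := by
  intro j hj
  induction j with
  | zero => simp at hj
  | succ j ih =>
    rcases j with _ | j
    · exact singleMSE_le hσ 1 hj
    · have hj' : j + 1 ∈ Finset.Icc 1 k := by simp at hj ⊢; omega
      exact combinedMSE_le (Nat.cast_pos.2 (hn _ hj))
        (forwardSize_pos hn (fun _ => norm_nonneg _) (fun _ => norm_nonneg _) _ hj')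
        ((pow_pos (hσ _ hj i).1 2).trans_le (sq_apply_le_norm _ i)) (norm_sq_le (hσ _ hj))
        (sq_nonneg _) (sq_apply_le_norm _ i) (singleMSE_pos hn hσ _ hj)
        (forwardMSE_pos (singleMSE_pos hn hσ) _ hj') (singleMSE_le hσ _ hj) (ih hj')

lemma backwardMSE_le (hn : ∀ j ∈ Finset.Icc 1 k, 0 < n j)
    (hσ : ∀ j ∈ Finset.Icc 1 k, ∀ i, 0 < σ j i ∧ σ j i ≤ M) :
    ∀ j ∈ Finset.Icc 1 k, backwardMSE (singleMSE σ n) d k j i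
      ≤ M ^ 2 / backwardSize n (fun j => ‖σ j ^ 2‖) (fun j => ‖d j ^ 2‖) k j := by
  intro j hj
  obtain ⟨hj0, hjk⟩ := Finset.mem_Icc.1 hj
  clear hj
  induction hjk using Nat.decreasingInduction with
  | self =>
    have hj := Finset.mem_Icc.2 ⟨hj0, le_rfl⟩
    rw [backwardMSE, if_neg (lt_irrefl k), backwardSize, if_neg (lt_irrefl k)]
    exact singleMSE_le hσ k hj
  | of_succ j hjk ih =>
    have hj : 1 ≤ j ∧ j ≤ k := ⟨hj0, hjk.le⟩
    have hj1 : 1 ≤ j + 1 ∧ j + 1 ≤ k := ⟨by omega, hjk⟩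
    have hj' := Finset.mem_Icc.2 hj
    rw [backwardMSE, if_pos hjk, backwardSize, if_pos hjk]
    exact combinedMSE_le (Nat.cast_pos.2 (hn _ hj'))
      (backwardSize_pos hn (fun _ => norm_nonneg _) (fun _ => norm_nonneg _) _
        (Finset.mem_Icc.2 hj1))
      ((pow_pos (hσ _ hj' i).1 2).trans_le (sq_apply_le_norm _ i)) (norm_sq_le (hσ _ hj'))
      (sq_nonneg _) (sq_apply_le_norm _ i) (singleMSE_pos hn hσ _ hj')
      (backwardMSE_pos (singleMSE_pos hn hσ) _ (Finset.mem_Icc.2 hj1)) (singleMSE_le hσ _ hj')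
      (ih hj1.1)

lemma smoothMSE_le (hn : ∀ j ∈ Finset.Icc 1 k, 0 < n j)
    (hσ : ∀ j ∈ Finset.Icc 1 k, ∀ i, 0 < σ j i ∧ σ j i ≤ M) :
    ∀ j ∈ Finset.Icc 1 k, smoothMSE (singleMSE σ n) d k j i
      ≤ M ^ 2 / smoothSize n (fun j => ‖σ j ^ 2‖) (fun j => ‖d j ^ 2‖) k j := by
  intro j hj
  have hj' := Finset.mem_Icc.1 hj
  rw [smoothMSE, smoothSize]
  split_ifs with h
  · have hj1 : j + 1 ∈ Finset.Icc 1 k := Finset.mem_Icc.2 ⟨by omega, h⟩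
    exact combinedMSE_le
      (forwardSize_pos hn (fun _ => norm_nonneg _) (fun _ => norm_nonneg _) _ hj)
      (backwardSize_pos hn (fun _ => norm_nonneg _) (fun _ => norm_nonneg _) _ hj1)
      ((pow_pos (hσ _ hj i).1 2).trans_le (sq_apply_le_norm _ i)) (norm_sq_le (hσ _ hj))
      (sq_nonneg _) (sq_apply_le_norm _ i) (forwardMSE_pos (singleMSE_pos hn hσ) _ hj)
      (backwardMSE_pos (singleMSE_pos hn hσ) _ hj1) (forwardMSE_le hn hσ _ hj)
      (backwardMSE_le hn hσ _ hj1)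
  · exact forwardMSE_le hn hσ k (Finset.mem_Icc.2 ⟨by omega, le_rfl⟩)

end Sizes

/-! ### Risk bounds -/

section RiskBounds

variable {Ω X Y : Type*} [MeasurableSpace Ω] [MeasurableSpace X] [Fintype Y] [MeasurableSpace Y]
  [MeasurableSingletonClass Y] {P : Measure Ω} [IsProbabilityMeasure P]
  {m : ℕ} {Φ : X → Y → Fin m → ℝ} {M κ : ℝ} {k : ℕ} {n : ℕ → ℕ} {p : ℕ → Ω → Measure (X × Y)}
  {D : ℕ → ℕ → Ω → X × Y} {σ d : ℕ → Fin m → ℝ}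

/-- Each component of a linear estimate with variance `v` has an error that exceeds
`κ √v √(2 L)` with probability at most `2 exp (-L)`. -/
lemma measure_deviation_le (hΦ : ∀ y i, Measurable fun x => Φ x y i) (hM : ∀ x y i, |Φ x y i| ≤ M)
    (hn : ∀ j ∈ Finset.Icc 1 k, 0 < n j) (htasks : EvolvingTasks P k n p D)
    (hκσ : ∀ j ∈ Finset.Icc 1 k, ∀ i, ∀ᵐ ω ∂P,
      SubGaussianLE (fun z => Φ z.1 z.2 i) (κ * σ j i) (p j ω))
    (hκd : ∀ j ∈ Finset.Icc 2 k, ∀ i,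
      SubGaussianLE (fun ω => featureMean Φ (p j ω) i - featureMean Φ (p (j - 1) ω) i)
        (κ * d j i) P)
    (hκ : 0 ≤ κ) {j : ℕ} {i : Fin m} {v : ℝ} (hv : 0 ≤ v)
    {est : (ℕ → Fin m → ℝ) → Fin m → ℝ}
    (hest : IsLinearEstimate (singleMSE σ n) d i (Finset.Icc 1 k) (Finset.Icc 2 k) est j v)
    {L : ℝ} (hL : 0 ≤ L) :
    P {ω | κ * √v * √(2 * L)
        < |est (sampleMean Φ n fun j i => D j i ω) i - featureMean Φ (p j ω) i|}
      ≤ ENNReal.ofReal (2 * Real.exp (-L)) := by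
  obtain ⟨α, β, -, -, hest, hv'⟩ := hest
  -- the error is a fixed linear combination of sampling errors and changes
  have h := htasks.hasSubgaussianMGF hn (f := fun z : X × Y => Φ z.1 z.2 i) (σ := fun j => σ j i)
    (d := fun j => d j i) (κ := κ) (measurable_uncurry (f := fun x y => Φ x y i) fun y => hΦ y i)
    (fun z => hM z.1 z.2 i) (fun j hj => hκσ j hj i) (fun j hj => hκd j hj i) α β
  have e : κ ^ 2 * (∑ j ∈ Finset.Icc 1 k, α j ^ 2 * (σ j i ^ 2 / n j)
      + ∑ j ∈ Finset.Icc 2 k, β j ^ 2 * d j i ^ 2) = (κ * √v) ^ 2 := by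
    rw [mul_pow, Real.sq_sqrt hv, ← hv']
    rfl
  rw [e] at h
  convert measure_abs_gt_le h (by positivity) hL using 5 with ω
  exact congrArg abs (hest (sampleMean Φ n fun j i => D j i ω) fun j => featureMean Φ (p j ω))

/-- The risk bound for the estimate of a single mean vector with small deviations. The factor
`κ + 1` absorbs the confidence vector because `2 * log (2 * m / δ) ≥ 1`. -/
lemma riskBound_of_deviation_le [Nonempty X] [Nonempty Y]
    (hΦ : ∀ y i, Measurable fun x => Φ x y i) (hM : ∀ x y i, |Φ x y i| ≤ M)
    (q : Measure (X × Y)) [IsProbabilityMeasure q]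
    (hreg : IsClosed (Set.range Φ) ∨ featureMean Φ q ∈
      intrinsicInterior ℝ (convexHull ℝ (Set.range fun z : X × Y => Φ z.1 z.2)))
    {δ N : ℝ} {τ v : Fin m → ℝ} (hM0 : ∀ _ : Fin m, 0 ≤ M) (hκ : ∀ _ : Fin m, 0 ≤ κ)
    (hL : ∀ _ : Fin m, 1 ≤ 2 * Real.log (2 * m / δ)) (hN : ∀ i, v i ≤ M ^ 2 / N)
    (hdev : ∀ i, |τ i - featureMean Φ q i| ≤ κ * √(v i) * √(2 * Real.log (2 * m / δ))) :
    RiskBound Φ M κ δ (featureMean Φ q) τ v N := by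
  intro μ hμ
  refine (minimaxRisk_le_add hΦ hM q hreg (fun i => Real.sqrt_nonneg (v i)) hμ).trans
    (add_le_add_right ?_ _)
  rw [Finset.mul_sum]
  refine Finset.sum_le_sum fun i _ => mul_le_mul_of_nonneg_right ?_ (abs_nonneg _)
  set l := √(2 * Real.log (2 * m / δ)) with hl
  have hl1 : 1 ≤ l := Real.one_le_sqrt.2 (hL i)
  have h1 : √(v i) ≤ M / √N := by
    rw [← Real.sqrt_sq (hM0 i), ← Real.sqrt_div (sq_nonneg M)]
    exact Real.sqrt_le_sqrt (hN i)
  have hκi := hκ i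
  calc |τ i - featureMean Φ q i| + √(v i) ≤ κ * √(v i) * l + √(v i) * l :=
        add_le_add (hdev i) (le_mul_of_one_le_right (Real.sqrt_nonneg _) hl1)
    _ = √(v i) * ((κ + 1) * l) := by ring
    _ ≤ M / √N * ((κ + 1) * l) := mul_le_mul_of_nonneg_right h1 (by positivity)
    _ = M * (κ + 1) * l / √N := by ring

/-- The risk bound holds with high probability for linear estimates of the mean vector of a task
whose variances are at most `M ^ 2 / N`, by a union bound over the components. -/
theorem measure_not_riskBound_le (hΦ : ∀ y i, Measurable fun x => Φ x y i)
    (hM : ∀ x y i, |Φ x y i| ≤ M) (hn : ∀ j ∈ Finset.Icc 1 k, 0 < n j)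
    (htasks : EvolvingTasks P k n p D)
    (hreg : IsClosed (Set.range Φ) ∨ ∀ j ∈ Finset.Icc 1 k, ∀ᵐ ω ∂P,
      featureMean Φ (p j ω) ∈
        intrinsicInterior ℝ (convexHull ℝ (Set.range fun z : X × Y => Φ z.1 z.2)))
    (hσ : ∀ j ∈ Finset.Icc 1 k, ∀ i, 0 < σ j i ∧ σ j i ≤ M)
    (hκσ : ∀ j ∈ Finset.Icc 1 k, ∀ i, ∀ᵐ ω ∂P,
      SubGaussianLE (fun z => Φ z.1 z.2 i) (κ * σ j i) (p j ω))
    (hκd : ∀ j ∈ Finset.Icc 2 k, ∀ i,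
      SubGaussianLE (fun ω => featureMean Φ (p j ω) i - featureMean Φ (p (j - 1) ω) i)
        (κ * d j i) P)
    {δ : ℝ} (hδ : 0 < δ) (hδ1 : δ < 1) {j : ℕ} (hj : j ∈ Finset.Icc 1 k) {v : Fin m → ℝ} {N : ℝ}
    {est : (ℕ → Fin m → ℝ) → Fin m → ℝ} (hv : ∀ i, 0 < v i) (hN : ∀ i, v i ≤ M ^ 2 / N)
    (hest : ∀ i,
      IsLinearEstimate (singleMSE σ n) d i (Finset.Icc 1 k) (Finset.Icc 2 k) est j (v i)) :
    P {ω | ¬ RiskBound Φ M κ δ (featureMean Φ (p j ω))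
        (est (sampleMean Φ n fun j i => D j i ω)) v N} ≤ ENNReal.ofReal δ := by
  have hprob := htasks.isProbabilityMeasure j hj
  obtain ⟨ω₀⟩ : Nonempty Ω := nonempty_of_isProbabilityMeasure P
  obtain ⟨x₀, y₀⟩ : Nonempty (X × Y) := nonempty_of_isProbabilityMeasure (p j ω₀)
  have : Nonempty X := ⟨x₀⟩
  have : Nonempty Y := ⟨y₀⟩
  have hM0 : ∀ _ : Fin m, 0 ≤ M := fun i => (abs_nonneg _).trans (hM x₀ y₀ i)
  have hκ : ∀ _ : Fin m, 0 ≤ κ := fun i => by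
    obtain ⟨ω, hω⟩ := (hκσ j hj i).exists
    exact nonneg_of_mul_nonneg_left hω.1 (hσ j hj i).1
  have hm1 : ∀ _ : Fin m, (1 : ℝ) ≤ m := fun i => by exact_mod_cast i.pos
  have hL : ∀ _ : Fin m, 1 ≤ 2 * Real.log (2 * m / δ) := fun i => by
    have h2 : (2 : ℝ) ≤ 2 * m / δ := by
      rw [le_div_iff₀ hδ]
      linarith [hm1 i]
    have h3 := Real.log_le_log (by norm_num) h2
    linarith [Real.log_two_gt_d9]
  set dev : Fin m → Set Ω := fun i => {ω | κ * √(v i) * √(2 * Real.log (2 * m / δ))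
    < |est (sampleMean Φ n fun j i => D j i ω) i - featureMean Φ (p j ω) i|} with hdev
  -- the null event on which the moment problem is not regular
  set sing : Set Ω := {ω | ¬ (IsClosed (Set.range Φ) ∨ featureMean Φ (p j ω) ∈
    intrinsicInterior ℝ (convexHull ℝ (Set.range fun z : X × Y => Φ z.1 z.2)))} with hsing
  have hsing0 : P sing = 0 := by
    refine ae_iff.1 ?_
    rcases hreg with h | h
    · exact ae_of_all _ fun _ => Or.inl h
    · filter_upwards [h j hj] with ω hω using Or.inr hω
  have hsub : {ω | ¬ RiskBound Φ M κ δ (featureMean Φ (p j ω))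
      (est (sampleMean Φ n fun j i => D j i ω)) v N} ⊆ sing ∪ ⋃ i, dev i := by
    intro ω hω
    by_contra hnot
    rw [Set.mem_union, not_or, Set.mem_iUnion, not_exists] at hnot
    have := hprob ω
    exact hω (riskBound_of_deviation_le hΦ hM (p j ω) (not_not.1 hnot.1) hM0 hκ hL hN
      fun i => not_lt.1 (hnot.2 i))
  have hdevle : ∀ i, P (dev i) ≤ ENNReal.ofReal (δ / m) := fun i => by
    have hm := hm1 i
    refine (measure_deviation_le hΦ hM hn htasks hκσ hκd (hκ i) (hv i).le (hest i)
      (by linarith [hL i])).trans_eq ?_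
    rw [Real.exp_neg, Real.exp_log (by positivity)]
    congr 1
    field_simp
  calc P {ω | ¬ RiskBound Φ M κ δ (featureMean Φ (p j ω))
        (est (sampleMean Φ n fun j i => D j i ω)) v N}
      ≤ P sing + ∑ i, P (dev i) :=
        (measure_mono hsub).trans ((measure_union_le _ _).trans
          (add_le_add_right (measure_iUnion_fintype_le _ _) _))
    _ ≤ ∑ _i : Fin m, ENNReal.ofReal (δ / m) := by
        rw [hsing0, zero_add]
        exact Finset.sum_le_sum fun i _ => hdevle i
    _ ≤ ENNReal.ofReal δ := by
        rw [Finset.sum_const, Finset.card_univ, Fintype.card_fin, nsmul_eq_mul,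
          ← ENNReal.ofReal_natCast, ← ENNReal.ofReal_mul (Nat.cast_nonneg m)]
        refine ENNReal.ofReal_le_ofReal ?_
        rcases m.eq_zero_or_pos with rfl | hm
        · simpa using hδ.le
        · have : (m : ℝ) ≠ 0 := by exact_mod_cast hm.ne'
          exact (mul_div_cancel₀ δ this).le

end RiskBounds

end LMRC

theorem theorem3 {Ω X Y : Type*} [MeasurableSpace Ω] [MeasurableSpace X]
    [Fintype Y] [MeasurableSpace Y] [MeasurableSingletonClass Y]
    (P : Measure Ω) [IsProbabilityMeasure P]
    -- the feature mapping, bounded by `M`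
    {m : ℕ} (Φ : X → Y → Fin m → ℝ) (M : ℝ)
    (hΦ : ∀ y i, Measurable fun x => Φ x y i)
    (hM : ∀ x y i, |Φ x y i| ≤ M)
    -- the tasks and their sample sets
    (k : ℕ) (hk : 1 ≤ k) (n : ℕ → ℕ) (hn : ∀ j ∈ Finset.Icc 1 k, 0 < n j)
    (p : ℕ → Ω → Measure (X × Y)) (D : ℕ → ℕ → Ω → X × Y)
    (htasks : EvolvingTasks P k n p D)
    -- regularity of the moment problem
    (hreg : IsClosed (Set.range Φ) ∨ ∀ j ∈ Finset.Icc 1 k, ∀ᵐ ω ∂P,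
      featureMean Φ (p j ω) ∈
        intrinsicInterior ℝ (convexHull ℝ (Set.range fun z : X × Y => Φ z.1 z.2)))
    -- the values used for standard deviations and for changes, and the constant `κ`
    (σ d : ℕ → Fin m → ℝ) (hσ : ∀ j ∈ Finset.Icc 1 k, ∀ i, 0 < σ j i ∧ σ j i ≤ M)
    (κ : ℝ)
    (hκσ : ∀ j ∈ Finset.Icc 1 k, ∀ i, ∀ᵐ ω ∂P,
      SubGaussianLE (fun z => Φ z.1 z.2 i) (κ * σ j i) (p j ω))
    (hκd : ∀ j ∈ Finset.Icc 2 k, ∀ i,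
      SubGaussianLE (fun ω => featureMean Φ (p j ω) i - featureMean Φ (p (j - 1) ω) i)
        (κ * d j i) P) :
    -- forward, backward, and forward-and-backward effective sample sizes
    ∃ nF nB nFB : ℕ → ℝ,
      nF 1 = n 1 ∧
      (∀ j ∈ Finset.Icc 2 k, nF j ≥ n j
        + nF (j - 1) * (‖σ j ^ 2‖ / (‖σ j ^ 2‖ + nF (j - 1) * ‖d j ^ 2‖))) ∧
      nB k = n k ∧
      (∀ j ∈ Finset.Ico 1 k, nB j ≥ n j
        + nB (j + 1) * (‖σ j ^ 2‖ / (‖σ j ^ 2‖ + nB (j + 1) * ‖d (j + 1) ^ 2‖))) ∧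
      nFB k = nF k ∧
      (∀ j ∈ Finset.Ico 1 k, nFB j ≥ nF j
        + nB (j + 1) * (‖σ j ^ 2‖ / (‖σ j ^ 2‖ + nB (j + 1) * ‖d (j + 1) ^ 2‖))) ∧
      ∀ δ : ℝ, 0 < δ → δ < 1 → ∀ j ∈ Finset.Icc 1 k,
        -- the sizes `nF` are effective sample sizes of forward learning
        P {ω | ¬ RiskBound Φ M κ δ (featureMean Φ (p j ω))
            (forwardMean (sampleMean Φ n fun j i => D j i ω) (singleMSE σ n) d j)
            (forwardMSE (singleMSE σ n) d j) (nF j)} ≤ ENNReal.ofReal δ ∧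
        -- the bound for forward and backward learning
        P {ω | ¬ RiskBound Φ M κ δ (featureMean Φ (p j ω))
            (smoothMean (sampleMean Φ n fun j i => D j i ω) (singleMSE σ n) d k j)
            (smoothMSE (singleMSE σ n) d k j) (nFB j)} ≤ ENNReal.ofReal δ := by
  -- the recursions for the sizes hold with equality
  refine ⟨forwardSize n (fun j => ‖σ j ^ 2‖) fun j => ‖d j ^ 2‖,
    backwardSize n (fun j => ‖σ j ^ 2‖) (fun j => ‖d j ^ 2‖) k,
    smoothSize n (fun j => ‖σ j ^ 2‖) (fun j => ‖d j ^ 2‖) k, rfl, fun j hj => ?_, ?_,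
    fun j hj => ?_, ?_, fun j hj => ?_, fun δ hδ hδ1 j hj => ⟨?_, ?_⟩⟩
  · obtain ⟨j, rfl⟩ : ∃ l, j = l + 2 := ⟨j - 2, by rw [Finset.mem_Icc] at hj; omega⟩
    exact le_rfl
  · rw [backwardSize, if_neg (lt_irrefl k)]
  · rw [backwardSize.eq_1 _ _ _ _ j, if_pos (Finset.mem_Ico.1 hj).2]
    exact le_rfl
  · rw [smoothSize, if_neg (lt_irrefl k)]
  · rw [smoothSize, if_pos (Finset.mem_Ico.1 hj).2]
    exact le_rfl
  · exact measure_not_riskBound_le hΦ hM hn htasks hreg hσ hκσ hκd hδ hδ1 hj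
      (est := fun τ => forwardMean τ (singleMSE σ n) d j)
      (fun i => forwardMSE_pos (singleMSE_pos hn hσ) j hj) (fun i => forwardMSE_le hn hσ j hj)
      fun i => (isLinearEstimate_forwardMean (singleMSE_pos hn hσ) j hj).mono
        (Finset.Icc_subset_Icc_right (Finset.mem_Icc.1 hj).2)
        (Finset.Icc_subset_Icc_right (Finset.mem_Icc.1 hj).2)
  · exact measure_not_riskBound_le hΦ hM hn htasks hreg hσ hκσ hκd hδ hδ1 hj
      (est := fun τ => smoothMean τ (singleMSE σ n) d k j)
      (fun i => smoothMSE_pos (singleMSE_pos hn hσ) j hj) (fun i => smoothMSE_le hn hσ j hj)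
      fun i => isLinearEstimate_smoothMean (singleMSE_pos hn hσ) j hj
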